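/- Let $n\ge 2$ and $r>0$ be integers, and let $a_1,\dots,a_{n-1}$ be integers with $0\le a_j<r$ and $\gcd(a_1,r)=1$. Let $X=\mathbb{C}^n/\mathbb{Z}_r(1,a_1,\dots,a_{n-1})$ be the quotient of $\mathbb{C}^n$, with coordinates $x_0,\dots,x_{n-1}$, by the group of $r$-th roots of unity $\zeta$ acting by $x_0\mapsto\zeta x_0$, $x_j\mapsto\zeta^{a_j}x_j$ $(1\le j\le n-1)$, and let $o\in X$ be the image of the origin. Let $l$ be the least integer $i$ with $0<i\le r$ and $a_j i\equiv i \pmod r$ for all $1\le j\le n-1$. Let $\mu:Y\to X$ be the weighted blow-up of $X$ at $o$ with weights $\mathrm{wt}(x_0,x_1,\dots,x_{n-1})=(l/r,l/r,\dots,l/r)$, that is, $Y=\mathrm{Proj}\bigoplus_{k\ge 0}I_k$, where $I_k$ is the ideal of the invariant polynomials all of whose monomials have weight at least $k$. Let $E=\mu^{-1}(o)$, with its reduced structure, be the exceptional divisor. For an integer $h\ge 0$ let $\mu_*\mathcal{O}_Y(-hE)\subseteq\mathcal{O}_X$ be the ideal sheaf of the functions whose pull-back to $Y$ vanishes along $E$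 to order at least $h$. Then the weighted multiplicity of $X$ at $o$ for $\mu$ is $$\mathrm{w}\text{-}\mathrm{mult}_{\mu:o}X=\frac{r^{n-1}}{l^n}.$$ In other words, the spaces $\mathcal{O}_{X,o}/\mu_*\mathcal{O}_Y(-hE)$ are finite-dimensional over $\mathbb{C}$, and $$\dim_{\mathbb{C}}\frac{\mathcal{O}_{X,o}}{\mu_*\mathcal{O}_Y(-hE)}=\frac{r^{n-1}}{l^n}\cdot\frac{h^n}{n!}+O(h^{n-1})\qquad(h\to\infty).$$ -/

import Mathlib

open AlgebraicGeometry CategoryTheory Polynomial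
open scoped NNRat

noncomputable section

namespace WMult

/-! ### Weighted multiplicity of a point for a morphism with exceptional divisor over it -/

section WeightedMultiplicity

variable {X Y : Scheme.{0}}

/-- The generic points of the irreducible components of a closed subset `E`:
the points of `E` that are not proper specializations of other points of `E`. -/
def componentPoints (E : Set Y) : Set Y := {η | η ∈ E ∧ ∀ y ∈ E, y ⤳ η → y = η}

/-- The sections over `U` of the ideal sheaf `O_Y(-hE)`, where `E` is a reduced divisor, given by
its support: the functions whose order along each component of `E` meeting `U` is at least `h`,
i.e. whose germ at the generic point `η` of that component lies in the `h`-th power of the maximal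
ideal of the local ring `O_{Y,η}` (a discrete valuation ring if `Y` is normal). -/
def divisorIdeal (E : Set Y) (h : ℕ) (U : Y.Opens) : Ideal Γ(Y, U) :=
  ⨅ (η : Y) (_ : η ∈ componentPoints E) (hU : η ∈ U),
    Ideal.comap (Y.presheaf.germ U η hU).hom
      (IsLocalRing.maximalIdeal (Y.presheaf.stalk η) ^ h)

/-- The stalk at `x₀` of the ideal sheaf `μ_* O_Y(-hE) ⊆ O_X`, as an ideal of `O_{X,x₀}`, where
`E = μ⁻¹(x₀)` (with its reduced structure) is the exceptional divisor over `x₀`.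
The sections of `μ_* O_Y(-hE)` over `U` are the functions `s` on `U` such that `μ^*s` is a
section of `O_Y(-hE)` over `μ⁻¹(U)`; the stalk is generated by the germs of the sections over
all open neighbourhoods `U` of `x₀`. -/
def pushforwardIdeal (μ : Y ⟶ X) (x₀ : X) (h : ℕ) : Ideal (X.presheaf.stalk x₀) :=
  ⨆ (U : X.Opens) (hU : x₀ ∈ U),
    Ideal.map (X.presheaf.germ U x₀ hU).hom
      (Ideal.comap (μ.app U).hom (divisorIdeal (μ ⁻¹' {x₀}) h (μ ⁻¹ᵁ U)))

/-- The structure map `ℂ → O_{X,x₀}` for a scheme `X` over `ℂ`. -/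
def scalars (s : X ⟶ Spec (.of ℂ)) (x₀ : X) : ℂ →+* X.presheaf.stalk x₀ :=
  (X.presheaf.germ ⊤ x₀ trivial).hom.comp
    (s.appTop.hom.comp (Scheme.ΓSpecIso (.of ℂ)).inv.hom)

/-- The (possibly infinite) dimension over `ℂ` of `O_{X,x₀} / I`. -/
def dimQuotient (s : X ⟶ Spec (.of ℂ)) (x₀ : X) (I : Ideal (X.presheaf.stalk x₀)) : Cardinal :=
  letI : Module ℂ (X.presheaf.stalk x₀ ⧸ I) :=
    Module.compHom _ ((Ideal.Quotient.mk I).comp (scalars s x₀))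
  Module.rank ℂ (X.presheaf.stalk x₀ ⧸ I)

/-- `c` is the weighted multiplicity at `x₀` for `μ : Y ⟶ X` of the `p`-dimensional complex
scheme `X`: the spaces `O_{X,x₀} / μ_* O_Y(-hE)` are finite-dimensional, and their dimension is
`c * h ^ p / p!` plus terms of lower order in `h`, i.e. up to an error `O(h ^ (p - 1))`. -/
def HasWeightedMultiplicity (s : X ⟶ Spec (.of ℂ)) (μ : Y ⟶ X) (x₀ : X) (p : ℕ) (c : ℝ) : Prop :=
  ∃ d : ℕ → ℕ,
    (∀ h : ℕ, dimQuotient s x₀ (pushforwardIdeal μ x₀ h) = d h) ∧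
    (fun h : ℕ => (d h : ℝ) - c * (h : ℝ) ^ p / (p.factorial : ℝ))
      =O[Filter.atTop] fun h : ℕ => (h : ℝ) ^ ((p : ℤ) - 1)

/-- The weighted multiplicity is unique if it exists. -/
theorem HasWeightedMultiplicity.unique {s : X ⟶ Spec (.of ℂ)} {μ : Y ⟶ X} {x₀ : X} {p : ℕ}
    {c c' : ℝ} (hc : HasWeightedMultiplicity s μ x₀ p c)
    (hc' : HasWeightedMultiplicity s μ x₀ p c') : c = c' := by
  obtain ⟨d, hd, h1⟩ := hc
  obtain ⟨d', hd', h2⟩ := hc'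
  obtain rfl : d = d' := by
    funext h
    exact_mod_cast (hd h).symm.trans (hd' h)
  have h3 := h2.sub h1
  have h4 := h3.mul (Asymptotics.isBigO_refl (fun h : ℕ => (h : ℝ) ^ (-(p : ℤ))) Filter.atTop)
  have h5 : Filter.Tendsto (fun h : ℕ => (h : ℝ)⁻¹) Filter.atTop (nhds 0) :=
    tendsto_inv_atTop_nhds_zero_nat
  have h6 := (h4.trans_eventuallyEq (g₂ := fun h : ℕ => (h : ℝ)⁻¹) (by
    filter_upwards [Filter.eventually_gt_atTop 0] with h hh
    have : (h : ℝ) ≠ 0 := by positivity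
    rw [← zpow_add₀ this, ← zpow_neg_one]
    congr 1
    ring)).trans_tendsto h5
  have h7 : Filter.Tendsto (fun _ : ℕ => (c - c') / (p.factorial : ℝ)) Filter.atTop (nhds 0) := by
    refine h6.congr' ?_
    filter_upwards [Filter.eventually_gt_atTop 0] with h hh
    have : (h : ℝ) ≠ 0 := by positivity
    rw [zpow_neg, zpow_natCast]
    field_simp
    ring
  have h8 := tendsto_nhds_unique tendsto_const_nhds h7
  have h9 : (p.factorial : ℝ) ≠ 0 := by positivity
  field_simp at h8
  linarith

end WeightedMultiplicity

/-! ### The blow-up of a multiplicative filtration -/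

section Rees

variable {A : Type} [CommRing A]

/-- A decreasing multiplicative filtration of a ring by ideals `A = I 0 ⊇ I 1 ⊇ I 2 ⊇ ...`. -/
structure IdealFiltration (A : Type) [CommRing A] where
  I : ℕ → Ideal A
  zero : I 0 = ⊤
  anti : Antitone I
  mul : ∀ j k : ℕ, I j * I k ≤ I (j + k)

variable (F : IdealFiltration A)

/-- The Rees algebra `⨁ₖ I k Tᵏ ⊆ A[T]`. -/
def rees : Subalgebra A A[X] where
  carrier := {f | ∀ k, f.coeff k ∈ F.I k}
  mul_mem' {f g} hf hg k := by
    rw [Polynomial.coeff_mul]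
    refine Ideal.sum_mem _ fun x hx => ?_
    rw [← Finset.HasAntidiagonal.mem_antidiagonal.mp hx]
    exact F.mul _ _ (Ideal.mul_mem_mul (hf _) (hg _))
  add_mem' {f g} hf hg k := by
    rw [Polynomial.coeff_add]
    exact Ideal.add_mem _ (hf k) (hg k)
  algebraMap_mem' a k := by
    rw [Polynomial.algebraMap_apply, Algebra.algebraMap_self, RingHom.id_apply,
      Polynomial.coeff_C]
    split_ifs with hk
    · subst hk; rw [F.zero]; trivial
    · exact Ideal.zero_mem _

/-- The degree `k` part `I k Tᵏ` of the Rees algebra. -/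
def reesPart (k : ℕ) : Submodule A (rees F) where
  carrier := {f | ∀ j, j ≠ k → (f : A[X]).coeff j = 0}
  add_mem' {f g} hf hg j hj := by simp [hf j hj, hg j hj]
  zero_mem' j _ := by simp
  smul_mem' a f hf j hj := by simp [hf j hj]

/-- The degree `k` component of an element of the Rees algebra. -/
def reesComponent (k : ℕ) (f : rees F) : reesPart F k :=
  ⟨⟨Polynomial.monomial k ((f : A[X]).coeff k), fun j => by
      rw [Polynomial.coeff_monomial]
      split_ifs with h
      · subst h; exact f.2 k
      · exact Ideal.zero_mem _⟩,
    fun j hj => by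
      change (Polynomial.monomial k ((f : A[X]).coeff k)).coeff j = 0
      rw [Polynomial.coeff_monomial, if_neg (Ne.symm hj)]⟩

theorem reesComponent_coeff (k : ℕ) (f : rees F) (j : ℕ) :
    (((reesComponent F k f : reesPart F k) : rees F) : A[X]).coeff j =
      if k = j then (f : A[X]).coeff k else 0 :=
  Polynomial.coeff_monomial

theorem coeff_coeAddMonoidHom (x : DirectSum ℕ fun k => reesPart F k) (j : ℕ) :
    ((DirectSum.coeAddMonoidHom (reesPart F) x : rees F) : A[X]).coeff j =
      ((x j : rees F) : A[X]).coeff j := by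
  induction x using DirectSum.induction_on with
  | zero => simp
  | of i y =>
    rw [DirectSum.coeAddMonoidHom_of]
    by_cases h : i = j
    · subst h; rw [DirectSum.of_eq_same]
    · rw [DirectSum.of_eq_of_ne _ _ _ (Ne.symm h)]
      simpa using y.2 j (Ne.symm h)
  | add x y hx hy => simp [hx, hy]

instance : SetLike.GradedMonoid (reesPart F) where
  one_mem j hj := by
    change (1 : A[X]).coeff j = 0
    rw [Polynomial.coeff_one, if_neg hj]
  mul_mem i j f g hf hg k hk := by
    change ((f : A[X]) * (g : A[X])).coeff k = 0
    rw [Polynomial.coeff_mul]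
    refine Finset.sum_eq_zero fun x hx => ?_
    rw [Finset.HasAntidiagonal.mem_antidiagonal] at hx
    by_cases h1 : x.1 = i
    · have h2 : x.2 ≠ j := fun h2 => hk (by rw [← hx, h1, h2])
      rw [hg _ h2, mul_zero]
    · rw [hf _ h1, zero_mul]

/-- The grading of the Rees algebra. -/
instance reesGradedRing : GradedRing (reesPart F) where
  decompose' f := DirectSum.mk _ (f : A[X]).support fun k => reesComponent F k f
  left_inv f := by
    apply Subtype.ext
    ext j
    rw [coeff_coeAddMonoidHom]
    by_cases h : j ∈ (f : A[X]).support
    · rw [DirectSum.mk_apply_of_mem h, reesComponent_coeff, if_pos rfl]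
    · rw [DirectSum.mk_apply_of_notMem h, Polynomial.notMem_support_iff.mp h]
      rfl
  right_inv x := by
    refine DFinsupp.ext fun k => Subtype.ext (Subtype.ext (Polynomial.ext fun j => ?_))
    by_cases h : k ∈ ((DirectSum.coeAddMonoidHom (reesPart F) x : rees F) : A[X]).support
    · rw [DirectSum.mk_apply_of_mem h, reesComponent_coeff, coeff_coeAddMonoidHom]
      split_ifs with hj
      · dsimp only at hj; rw [← hj]
      · exact ((x k).2 j (Ne.symm hj)).symm
    · rw [DirectSum.mk_apply_of_notMem h]
      rw [Polynomial.mem_support_iff, not_not, coeff_coeAddMonoidHom] at h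
      by_cases hj : j = k
      · subst hj; exact h.symm
      · exact ((x k).2 j hj).symm

/-- The blow-up `Proj (⨁ₖ I k Tᵏ)` of a filtration. -/
def blowup : Scheme.{0} := Proj (reesPart F)

/-- The map from `A` to the degree zero part of the Rees algebra, `a ↦ a T⁰`. -/
def toReesZero : A →+* reesPart F 0 := algebraMap A (reesPart F 0)

/-- The blow-up morphism `Proj (⨁ₖ I k Tᵏ) ⟶ Spec A`. -/
def blowupMap : blowup F ⟶ Spec (.of A) :=
  Proj.toSpecZero (reesPart F) ≫ Spec.map (CommRingCat.ofHom (toReesZero F))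

end Rees

/-! ### Cyclic quotient singularities and their weighted blow-ups -/

section Quotient

variable {n : ℕ} (r : ℕ) (a : Fin n → ℕ)

/-- The action of `ζ` on polynomials: `xᵢ ↦ ζ ^ aᵢ xᵢ`. -/
def act (ζ : ℂ) : MvPolynomial (Fin n) ℂ →ₐ[ℂ] MvPolynomial (Fin n) ℂ :=
  MvPolynomial.aeval fun i => MvPolynomial.C (ζ ^ a i) * MvPolynomial.X i

/-- The ring of polynomials that are invariant under the action, with weights `a`, of the
cyclic group of order `r` (realised as the group of `r`-th roots of unity `ζ`). -/
def invariants : Subalgebra ℂ (MvPolynomial (Fin n) ℂ) where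
  carrier := {f | ∀ ζ : ℂ, ζ ^ r = 1 → act a ζ f = f}
  mul_mem' hf hg ζ hζ := by rw [map_mul, hf ζ hζ, hg ζ hζ]
  add_mem' hf hg ζ hζ := by rw [map_add, hf ζ hζ, hg ζ hζ]
  algebraMap_mem' c ζ _ := AlgHom.commutes _ c

/-- The quotient variety `ℂⁿ/ℤ_r(a)`. -/
def quotientVariety : Scheme.{0} := Spec (.of (invariants r a))

/-- The structure morphism of `ℂⁿ/ℤ_r(a)`. -/
def quotientStructure : quotientVariety r a ⟶ Spec (.of ℂ) :=
  Spec.map (CommRingCat.ofHom (algebraMap ℂ (invariants r a)))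

/-- The quotient morphism `ℂⁿ ⟶ ℂⁿ/ℤ_r(a)`. -/
def quotientMap : Spec (.of (MvPolynomial (Fin n) ℂ)) ⟶ quotientVariety r a :=
  Spec.map (CommRingCat.ofHom (invariants r a).val.toRingHom)

/-- The origin of `ℂⁿ`: the prime ideal of the polynomials that vanish at `0`. -/
def affineOrigin (n : ℕ) : Spec (.of (MvPolynomial (Fin n) ℂ)) :=
  ⟨RingHom.ker (MvPolynomial.constantCoeff : MvPolynomial (Fin n) ℂ →+* ℂ),
    RingHom.ker_isPrime _⟩

/-- The image of the origin in `ℂⁿ/ℤ_r(a)`. -/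
def origin : quotientVariety r a := quotientMap r a (affineOrigin n)

variable (w : Fin n → ℚ≥0)

/-- The ideal of the polynomials all of whose monomials `x ^ b` have weight
`∑ᵢ bᵢ wᵢ` at least `k`. -/
def weightIdeal (k : ℕ) : Ideal (MvPolynomial (Fin n) ℂ) where
  carrier := {f | ∀ b ∈ f.support, (k : ℚ≥0) ≤ Finsupp.weight w b}
  add_mem' {f g} hf hg b hb := by
    classical
    rcases Finset.mem_union.mp (MvPolynomial.support_add hb) with h | h
    · exact hf b h
    · exact hg b h
  zero_mem' b hb := by simp at hb
  smul_mem' f g hg b hb := by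
    classical
    obtain ⟨u, _, v, hv, rfl⟩ := Finset.mem_add.mp (MvPolynomial.support_mul f g hb)
    rw [map_add]
    exact (hg v hv).trans le_add_self

/-- The filtration of the ring of invariants by the weight. -/
def weightFiltration : IdealFiltration (invariants r a) where
  I k := (weightIdeal w k).comap (invariants r a).val
  zero := by
    rw [Ideal.eq_top_iff_one]
    intro b _
    simp
  anti j k hjk f hf b hb := le_trans (by exact_mod_cast hjk) (hf b hb)
  mul j k := by
    classical
    rw [Ideal.mul_le]
    intro f hf g hg b hb
    rw [map_mul] at hb
    obtain ⟨u, hu, v, hv, rfl⟩ := Finset.mem_add.mp (MvPolynomial.support_mul _ _ hb)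
    rw [map_add, Nat.cast_add]
    exact add_le_add (hf u hu) (hg v hv)

/-- The weighted blow-up of `ℂⁿ/ℤ_r(a)` at the origin with weights `wt(xᵢ) = wᵢ`: the `Proj` of
`⨁ₖ {f : wt f ≥ k}`, where `f` runs over the regular functions on the quotient. It is meant for
weight vectors `w` in the lattice `ℤⁿ + ℤ (1/r) (a₀, ..., aₙ₋₁)`, as usual. -/
def weightedBlowup : Scheme.{0} := blowup (weightFiltration r a w)

/-- The morphism from the weighted blow-up to `ℂⁿ/ℤ_r(a)`. -/
def weightedBlowupMap : weightedBlowup r a w ⟶ quotientVariety r a :=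
  blowupMap (weightFiltration r a w)

end Quotient

end WMult

end

namespace WMult

/-! ### Germs of functions on affine schemes and on `Proj` -/

section Germs

open HomogeneousLocalization

/-! Since $l$ divides $r$, put $g=r/l$. A monomial has weight equal to its degree divided by $g$,
and an invariant monomial has degree divisible by $g$. So $I_k$ consists of the invariants whose
order at the origin is at least $gk$. Orders add under multiplication, and minimality of $l$ makes
the degrees of invariant monomials generate $g\mathbb{Z}$. Hence order$/g$ behaves as a discrete
valuation with value group $\mathbb{Z}$ (`weightFiltration_isValuative`).

For such a filtration $\bigoplus_k I_{k+1}T^k$ is a prime of the Rees algebra, and it defines a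
point over $o$. It is the only generic point of $E$, because $\bigoplus_k I_{k+1}T^k$ lies in the
radical of the ideal generated by $I_1$ in degree zero (`weightFiltration_succ_le_span`). The powers
of the maximal ideal of its local ring induce the filtration $I_h$ on functions, so
$\mu_*\mathcal{O}_Y(-hE)$ is the localization of $I_h$ at $o$ (`pushforwardIdeal_blowupMap`).

Localizing does not change the colength of $I_h$ (`dimQuotient_map_specToStalk`), which is the
number of invariant monomials of degree less than $gh$ (`rank_quotient_weightFiltration`). As $x_0$
has weight $1$, asymptotically one monomial in $r$ is invariant. This gives
$(gh)^n/(r\,n!)+O(h^{n-1})$, and $g^n/r=r^{n-1}/l^n$. -/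

theorem topIso_inv_appTop (X : Scheme.{0}) :
    X.topIso.inv.appTop = (Scheme.Opens.topIso (⊤ : X.Opens)).hom := by
  have h : (Scheme.Opens.topIso (⊤ : X.Opens)).inv = (⊤ : X.Opens).ι.appTop := by
    simp; rfl
  rw [← Iso.inv_comp_eq_id, h, ← Scheme.Hom.comp_appTop, Scheme.toIso_inv_ι]
  rfl

/-- `Proj.toSpecZero` identifies all of `Proj` with the basic open set of $1$. Keeping $U$ variable
lets `subst` remove that identification. -/
theorem germ_appTop_of_eq_top {X Z : Scheme.{0}} (U : X.Opens) (e : U = ⊤) (f : U.toScheme ⟶ Z)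
    (s : Γ(Z, ⊤)) (t : Γ(X, U)) (h : f.appTop s = U.topIso.inv t) (y : X) (hy : y ∈ U) :
    X.presheaf.germ ⊤ y trivial ((X.topIso.inv ≫ (X.isoOfEq e).inv ≫ f).appTop s) =
      X.presheaf.germ U y hy t := by
  subst e
  have h1 : X.topIso.inv.appTop (f.appTop s) = t := by
    rw [h, topIso_inv_appTop]
    exact Iso.inv_hom_id_apply _ _
  rw [Scheme.isoOfEq_rfl, ← h1]
  rfl

/-- The pull-back of a function under `Proj 𝒜 ⟶ Spec (𝒜 0)` has the expected germs. -/
theorem stalkIso_germ_toSpecZero {σ : Type*} {A : Type} [CommRing A] [SetLike σ A]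
    [AddSubgroupClass σ A] (𝒜 : ℕ → σ) [GradedRing 𝒜] (y : Proj 𝒜) (a : 𝒜 0) :
    (Proj.stalkIso 𝒜 y).hom ((Proj 𝒜).presheaf.germ ⊤ y trivial
      ((Proj.toSpecZero 𝒜).appTop ((Scheme.ΓSpecIso (.of (𝒜 0))).inv a))) =
      fromZeroRingHom 𝒜 _ a := by
  rw [Proj.toSpecZero, germ_appTop_of_eq_top
    (t := Proj.awayToSection 𝒜 1 (fromZeroRingHom 𝒜 _ a)) (hy := by simp)]
  · exact Proj.stalkIso'_germ 𝒜 _ y _ _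
  · have h : (Proj.basicOpenToSpec 𝒜 1).appTop = _ := Proj.basicOpenToSpec_app_top 𝒜 1
    rw [Scheme.Hom.comp_appTop, h]
    have h2 := congr($(Scheme.ΓSpecIso_inv_naturality
      (CommRingCat.ofHom (fromZeroRingHom 𝒜 (Submonoid.powers 1)))) a)
    have h3 : (Scheme.ΓSpecIso _).hom ((Scheme.ΓSpecIso (.of (Away 𝒜 1))).inv
        (fromZeroRingHom 𝒜 (Submonoid.powers 1) a)) = fromZeroRingHom 𝒜 (Submonoid.powers 1) a :=
      Iso.inv_hom_id_apply _ _
    refine Eq.trans ?_ congr((Proj.basicOpen 𝒜 1).topIso.inv (Proj.awayToSection 𝒜 1 $h3))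
    exact congr((Proj.basicOpen 𝒜 1).topIso.inv (Proj.awayToSection 𝒜 1
      ((Scheme.ΓSpecIso (.of (Away 𝒜 1))).hom $h2.symm)))

/-- The localization map from a ring to the stalk of its spectrum at a point. -/
noncomputable def specToStalk {A : Type} [CommRing A] (x : Spec (.of A)) :
    A →+* (Spec (.of A)).presheaf.stalk x :=
  ((Spec (.of A)).presheaf.germ ⊤ x trivial).hom.comp (Scheme.ΓSpecIso (.of A)).inv.hom

instance isPrime_asIdeal {A : Type} [CommRing A] (x : Spec (.of A)) : x.asIdeal.IsPrime := x.isPrime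

theorem isLocalization_specToStalk {A : Type} [CommRing A] (x : Spec (.of A)) :
    letI := (specToStalk x).toAlgebra
    IsLocalization.AtPrime ((Spec (.of A)).presheaf.stalk x) x.asIdeal :=
  StructureSheaf.IsLocalization.to_stalk A x

theorem specToStalk_isUnit_iff {A : Type} [CommRing A] (x : Spec (.of A)) (a : A) :
    IsUnit (specToStalk x a) ↔ a ∉ x.asIdeal := by
  let _ := (specToStalk x).toAlgebra
  have := isLocalization_specToStalk x
  exact IsLocalization.AtPrime.isUnit_to_map_iff ((Spec (.of A)).presheaf.stalk x) x.asIdeal a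

theorem exists_mul_specToStalk_eq {A : Type} [CommRing A] (x : Spec (.of A))
    (z : (Spec (.of A)).presheaf.stalk x) :
    ∃ a b : A, b ∉ x.asIdeal ∧ z * specToStalk x b = specToStalk x a := by
  let _ := (specToStalk x).toAlgebra
  have := isLocalization_specToStalk x
  obtain ⟨⟨a, b⟩, h⟩ := IsLocalization.surj x.asIdeal.primeCompl z
  exact ⟨a, b, b.2, h⟩

theorem mem_map_specToStalk_iff {A : Type} [CommRing A] (x : Spec (.of A)) (I : Ideal A) (a : A) :
    specToStalk x a ∈ I.map (specToStalk x) ↔ ∃ b ∉ x.asIdeal, b * a ∈ I := by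
  let _ := (specToStalk x).toAlgebra
  have := isLocalization_specToStalk x
  exact (IsLocalization.algebraMap_mem_map_algebraMap_iff x.asIdeal.primeCompl _ I a).trans
    ⟨fun ⟨b, hb, h⟩ => ⟨b, hb, h⟩, fun ⟨b, hb, h⟩ => ⟨b, hb, h⟩⟩

end Germs

/-! ### The exceptional divisor of the blow-up of a filtration -/

section Blowup

open HomogeneousLocalization

variable {A : Type} [CommRing A] (F : IdealFiltration A)

instance isPrime_toIdeal (y : Proj (reesPart F)) : y.asHomogeneousIdeal.toIdeal.IsPrime := y.isPrime

/-- The stalk of the blow-up at `y` as a homogeneous localization of the Rees algebra. -/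
noncomputable def blowupStalkEquiv (y : Proj (reesPart F)) :
    (blowup F).presheaf.stalk y ≃+*
      HomogeneousLocalization.AtPrime (reesPart F) y.asHomogeneousIdeal.toIdeal :=
  (Proj.stalkIso (reesPart F) y).commRingCatIsoToRingEquiv

/-- The germ at a point of the blow-up of the pull-back of a function. -/
theorem blowupStalkEquiv_stalkMap (y : Proj (reesPart F)) (a : A) :
    blowupStalkEquiv F y ((blowupMap F).stalkMap y (specToStalk (blowupMap F y) a)) =
      fromZeroRingHom (reesPart F) _ (toReesZero F a) := by
  rw [← stalkIso_germ_toSpecZero]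
  have h := congr($(Scheme.ΓSpecIso_inv_naturality
    (show CommRingCat.of A ⟶ CommRingCat.of (reesPart F 0) from
      CommRingCat.ofHom (toReesZero F))) a)
  refine congr((Proj.stalkIso (reesPart F) y).hom $(Scheme.Hom.germ_stalkMap_apply (blowupMap F) ⊤ y
    trivial ((Scheme.ΓSpecIso (.of A)).inv a))).trans ?_
  exact congr((Proj.stalkIso (reesPart F) y).hom ((Proj (reesPart F)).presheaf.germ ⊤ y trivial
      ((Proj.toSpecZero (reesPart F)).appTop $h.symm)))

/-- The stalk map is local, so $a$ vanishes at the image of $y$ exactly when its pull-back $a/1$ is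
a nonunit at $y$. -/
theorem mem_blowupMap_asIdeal_iff (y : Proj (reesPart F)) (a : A) :
    a ∈ (blowupMap F y).asIdeal ↔
      ((toReesZero F a : reesPart F 0) : rees F) ∈ y.asHomogeneousIdeal.toIdeal := by
  have h1 : IsLocalHom ((blowupMap F).stalkMap y).hom :=
    (inferInstance : ∀ z : blowup F, IsLocalHom ((blowupMap F).stalkMap z).hom) y
  have h2 : IsUnit ((blowupMap F).stalkMap y (specToStalk (blowupMap F y) a)) ↔
      IsUnit (specToStalk (blowupMap F y) a) := isUnit_map_iff ((blowupMap F).stalkMap y).hom _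
  have h3 (z) : IsUnit (blowupStalkEquiv F y z) ↔ IsUnit z :=
    MulEquiv.isUnit_map (blowupStalkEquiv F y).toMulEquiv
  rw [← not_iff_not, ← specToStalk_isUnit_iff, ← h2, ← h3, blowupStalkEquiv_stalkMap,
    ← isUnit_iff_isUnit_val]
  change IsUnit (Localization.mk _ 1) ↔ _
  rw [Localization.mk_one_eq_algebraMap]
  exact IsLocalization.AtPrime.isUnit_to_map_iff _ y.asHomogeneousIdeal.toIdeal _

end Blowup
end WMult

namespace WMult

/-! ### Valuative filtrations and the local ring at the exceptional point -/

section LeadingForms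

open HomogeneousLocalization

variable {A : Type} [CommRing A] (F : IdealFiltration A)

/-- The element `a Tᵏ` of the Rees algebra. -/
noncomputable def reesMonomial (k : ℕ) (a : A) (ha : a ∈ F.I k) : rees F :=
  ⟨monomial k a, fun j => by
    rw [coeff_monomial]
    split_ifs with h
    · exact h ▸ ha
    · exact Ideal.zero_mem _⟩

theorem coe_reesMonomial (k : ℕ) (a : A) (ha : a ∈ F.I k) :
    (reesMonomial F k a ha : A[X]) = monomial k a := rfl

theorem reesMonomial_mem (k : ℕ) (a : A) (ha : a ∈ F.I k) :
    reesMonomial F k a ha ∈ reesPart F k :=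
  fun j hj => by rw [coe_reesMonomial, coeff_monomial, if_neg (Ne.symm hj)]

theorem coe_toReesZero (a : A) :
    (((toReesZero F a : reesPart F 0) : rees F) : A[X]) = monomial 0 a := rfl

theorem coe_eq_monomial_of_mem_reesPart {k : ℕ} {f : rees F} (hf : f ∈ reesPart F k) :
    (f : A[X]) = monomial k ((f : A[X]).coeff k) := by
  ext j
  rw [coeff_monomial]
  split_ifs with h
  · rw [h]
  · exact hf j (Ne.symm h)

theorem coeff_decompose_self (f : rees F) (k : ℕ) :
    (((DirectSum.decompose (reesPart F) f k : reesPart F k) : rees F) : A[X]).coeff k =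
      (f : A[X]).coeff k := by
  rw [← coeff_coeAddMonoidHom]
  congr 2
  exact DirectSum.Decomposition.left_inv f

theorem decompose_eq_reesMonomial (f : rees F) (k : ℕ) :
    ((DirectSum.decompose (reesPart F) f k : reesPart F k) : rees F) =
      reesMonomial F k ((f : A[X]).coeff k) (f.2 k) := by
  apply Subtype.ext
  rw [coe_eq_monomial_of_mem_reesPart F (SetLike.coe_mem _), coeff_decompose_self]
  rfl

/-- The ideal `⨁ₖ I (k + h) Tᵏ` of the Rees algebra. -/
def shiftIdeal (h : ℕ) : Ideal (rees F) where
  carrier := {f | ∀ k, (f : A[X]).coeff k ∈ F.I (k + h)}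
  add_mem' {f g} hf hg k := by
    change ((f : A[X]) + (g : A[X])).coeff k ∈ _
    rw [coeff_add]
    exact Ideal.add_mem _ (hf k) (hg k)
  zero_mem' k := by simp
  smul_mem' f g hg k := by
    change ((f : A[X]) * (g : A[X])).coeff k ∈ _
    rw [coeff_mul]
    refine Ideal.sum_mem _ fun x hx => ?_
    rw [← Finset.HasAntidiagonal.mem_antidiagonal.mp hx, add_assoc]
    exact F.mul _ _ (Ideal.mul_mem_mul (f.2 _) (hg _))

theorem mem_shiftIdeal_of_mem_reesPart {h k : ℕ} {f : rees F} (hf : f ∈ reesPart F k) :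
    f ∈ shiftIdeal F h ↔ (f : A[X]).coeff k ∈ F.I (k + h) := by
  refine ⟨fun H => H k, fun H j => ?_⟩
  by_cases hj : j = k
  · exact hj ▸ H
  · rw [hf j hj]
    exact Ideal.zero_mem _

theorem reesMonomial_mem_shiftIdeal {h k : ℕ} {a : A} {ha : a ∈ F.I k} :
    reesMonomial F k a ha ∈ shiftIdeal F h ↔ a ∈ F.I (k + h) := by
  rw [mem_shiftIdeal_of_mem_reesPart F (reesMonomial_mem F k a ha), coe_reesMonomial,
    coeff_monomial_same]

theorem shiftIdeal_mul_le (i j : ℕ) :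
    shiftIdeal F i * shiftIdeal F j ≤ shiftIdeal F (i + j) := by
  rw [Ideal.mul_le]
  intro f hf g hg k
  change ((f : A[X]) * (g : A[X])).coeff k ∈ _
  rw [coeff_mul]
  refine Ideal.sum_mem _ fun x hx => ?_
  rw [← Finset.HasAntidiagonal.mem_antidiagonal.mp hx, add_add_add_comm]
  exact F.mul _ _ (Ideal.mul_mem_mul (hf _) (hg _))

theorem shiftIdeal_one_pow_le (h : ℕ) : shiftIdeal F 1 ^ h ≤ shiftIdeal F h := by
  induction h with
  | zero =>
    intro f _ k
    exact f.2 k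
  | succ h ih =>
    rw [pow_succ]
    exact (Ideal.mul_mono_left ih).trans (shiftIdeal_mul_le F h 1)

theorem shiftIdeal_isHomogeneous (h : ℕ) : (shiftIdeal F h).IsHomogeneous (reesPart F) := by
  intro k f hf
  rw [decompose_eq_reesMonomial]
  exact (reesMonomial_mem_shiftIdeal F).mpr (hf k)

/-- A filtration is valuative if its order function is a discrete valuation: leading forms
multiply, and the value group is all of `ℤ`. -/
structure IdealFiltration.IsValuative : Prop where
  ne_top : F.I 1 ≠ ⊤
  mem_or_mem : ∀ {j k : ℕ} {a b : A}, a ∈ F.I j → b ∈ F.I k → a * b ∈ F.I (j + k + 1) →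
    a ∈ F.I (j + 1) ∨ b ∈ F.I (k + 1)
  exists_consecutive : ∃ (k : ℕ) (u w : A), u ∈ F.I (k + 1) ∧ u ∉ F.I (k + 2) ∧
    w ∈ F.I k ∧ w ∉ F.I (k + 1)

variable {F} (hF : F.IsValuative)
include hF

/-- A factor of order exactly $k$ can be cancelled: its leading form is nonzero, so each further
step in the order of the product is a step in the order of $a$. -/
theorem IdealFiltration.IsValuative.mem_of_mul_mem {k h : ℕ} {a c : A} (hc : c ∈ F.I k)
    (hc' : c ∉ F.I (k + 1)) (hac : c * a ∈ F.I (k + h)) : a ∈ F.I h := by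
  induction h with
  | zero => rw [F.zero]; trivial
  | succ h ih =>
    exact (hF.mem_or_mem hc (ih (F.anti (by omega) hac)) hac).resolve_left hc'

/-- The quotient is the associated graded ring $\bigoplus_k I_k/I_{k+1}$. Primality may be tested on
homogeneous elements, where it says that leading forms multiply. -/
theorem shiftIdeal_one_isPrime : (shiftIdeal F 1).IsPrime := by
  refine (shiftIdeal_isHomogeneous F 1).isPrime_of_homogeneous_mem_or_mem ?_ ?_
  · intro h
    apply hF.ne_top
    have h1 := (Ideal.eq_top_iff_one _).mp h 0
    rw [Ideal.eq_top_iff_one]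
    change (1 : A[X]).coeff 0 ∈ _ at h1
    simpa using h1
  · rintro f g ⟨j, hf⟩ ⟨k, hg⟩ hfg
    have h1 := hfg (j + k)
    change ((f : A[X]) * (g : A[X])).coeff (j + k) ∈ _ at h1
    rw [coe_eq_monomial_of_mem_reesPart F hf, coe_eq_monomial_of_mem_reesPart F hg,
      monomial_mul_monomial, coeff_monomial_same] at h1
    rw [mem_shiftIdeal_of_mem_reesPart F hf, mem_shiftIdeal_of_mem_reesPart F hg]
    exact hF.mem_or_mem (f.2 j) (g.2 k) h1

/-- The generic point of the exceptional divisor of the blow-up of a valuative filtration. -/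
noncomputable def exceptionalPoint : Proj (reesPart F) where
  asHomogeneousIdeal := ⟨shiftIdeal F 1, shiftIdeal_isHomogeneous F 1⟩
  isPrime := shiftIdeal_one_isPrime hF
  not_irrelevant_le := by
    -- $uT^{k+1}$ has positive degree and lies outside the ideal, so the irrelevant ideal is not
    -- contained in it.
    obtain ⟨k, u, w, hu, hu', -⟩ := hF.exists_consecutive
    intro h
    refine hu' ((reesMonomial_mem_shiftIdeal F (ha := hu)).mp (h ?_))
    rw [HomogeneousIdeal.mem_irrelevant_iff, GradedRing.proj_apply, decompose_eq_reesMonomial]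
    apply Subtype.ext
    rw [coe_reesMonomial, coe_reesMonomial, coeff_monomial, if_neg (by omega), map_zero]
    rfl

theorem exceptionalPoint_toIdeal :
    (exceptionalPoint hF).asHomogeneousIdeal.toIdeal = shiftIdeal F 1 := rfl

theorem blowupMap_exceptionalPoint_asIdeal :
    (blowupMap F (exceptionalPoint hF)).asIdeal = F.I 1 := by
  ext a
  rw [mem_blowupMap_asIdeal_iff, exceptionalPoint_toIdeal,
    mem_shiftIdeal_of_mem_reesPart F (SetLike.coe_mem _), coe_toReesZero, coeff_monomial_same,
    zero_add]

theorem blowupMap_exceptionalPoint {x : Spec (.of A)} (hx : x.asIdeal = F.I 1) :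
    blowupMap F (exceptionalPoint hF) = x :=
  PrimeSpectrum.ext ((blowupMap_exceptionalPoint_asIdeal hF).trans hx.symm)

omit hF in
theorem mem_maximalIdeal_pow_map {R S : Type*} [CommRing R] [CommRing S] [IsLocalRing R]
    [IsLocalRing S] (f : R →+* S) [IsLocalHom f] {h : ℕ} {z : R}
    (hz : z ∈ IsLocalRing.maximalIdeal R ^ h) : f z ∈ IsLocalRing.maximalIdeal S ^ h := by
  have h1 := Ideal.mem_map_of_mem f hz
  rw [Ideal.map_pow] at h1
  have h2 : (IsLocalRing.maximalIdeal R).map f ≤ IsLocalRing.maximalIdeal S :=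
    ((IsLocalRing.local_hom_TFAE f).out 0 2).mp ‹_›
  exact Ideal.pow_right_mono h2 h h1

omit hF in
theorem ringEquiv_mem_maximalIdeal_pow_iff {R S : Type*} [CommRing R] [CommRing S] [IsLocalRing R]
    [IsLocalRing S] (e : R ≃+* S) {h : ℕ} {z : R} :
    e z ∈ IsLocalRing.maximalIdeal S ^ h ↔ z ∈ IsLocalRing.maximalIdeal R ^ h := by
  refine ⟨fun H => ?_, mem_maximalIdeal_pow_map (e : R →+* S)⟩
  simpa using mem_maximalIdeal_pow_map (e.symm : S →+* R) H

/-- In the full localization of the Rees algebra the maximal ideal is generated by `shiftIdeal F 1`,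
whose $h$-th power lies in `shiftIdeal F h`. Clearing denominators puts $ca$ in the latter for some
$c$ outside the prime. Some degree $k$ coefficient of $c$ has order exactly $k$ and can be
cancelled. -/
theorem mem_of_fromZeroRingHom_mem {h : ℕ} {a : A}
    (ha : fromZeroRingHom (reesPart F) _ (toReesZero F a) ∈
      IsLocalRing.maximalIdeal (HomogeneousLocalization.AtPrime (reesPart F)
        (exceptionalPoint hF).asHomogeneousIdeal.toIdeal) ^ h) : a ∈ F.I h := by
  have hloc : IsLocalHom (algebraMap (HomogeneousLocalization.AtPrime (reesPart F)
        (exceptionalPoint hF).asHomogeneousIdeal.toIdeal)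
        (Localization (exceptionalPoint hF).asHomogeneousIdeal.toIdeal.primeCompl)) :=
    ⟨fun z hz => by rwa [HomogeneousLocalization.algebraMap_apply, isUnit_iff_isUnit_val] at hz⟩
  have h1 := mem_maximalIdeal_pow_map
    (R := HomogeneousLocalization.AtPrime (reesPart F)
      (exceptionalPoint hF).asHomogeneousIdeal.toIdeal)
    (S := Localization.AtPrime (exceptionalPoint hF).asHomogeneousIdeal.toIdeal)
    (algebraMap _ (Localization (exceptionalPoint hF).asHomogeneousIdeal.toIdeal.primeCompl)) ha
  rw [← Localization.AtPrime.map_eq_maximalIdeal, ← Ideal.map_pow] at h1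
  have h2 := Ideal.map_mono (shiftIdeal_one_pow_le F h) h1
  change Localization.mk _ 1 ∈ _ at h2
  rw [Localization.mk_one_eq_algebraMap,
    IsLocalization.algebraMap_mem_map_algebraMap_iff
      (exceptionalPoint hF).asHomogeneousIdeal.toIdeal.primeCompl] at h2
  obtain ⟨c, hc, hca⟩ := h2
  obtain ⟨k, hk⟩ : ∃ k, (c : A[X]).coeff k ∉ F.I (k + 1) := by
    by_contra! H
    exact hc H
  refine hF.mem_of_mul_mem (c.2 k) hk ?_
  have h3 := hca k
  change ((c : A[X]) * monomial 0 a).coeff k ∈ _ at h3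
  rwa [monomial_zero_left, coeff_mul_C] at h3

/-- With $u,w$ of consecutive orders $k+1,k$, the fraction $\pi=uT^k/wT^k$ plays the role of a
uniformizer, and $a=x\pi^h$ with $x=aw^hT^{h(k+1)}/(uT^{k+1})^h$. The numerator of $x$ is legitimate
because $aw^h$ has order at least $h+hk$. -/
theorem fromZeroRingHom_mem_of_mem {h : ℕ} {a : A} (ha : a ∈ F.I h) :
    fromZeroRingHom (reesPart F) _ (toReesZero F a) ∈
      IsLocalRing.maximalIdeal (HomogeneousLocalization.AtPrime (reesPart F)
        (exceptionalPoint hF).asHomogeneousIdeal.toIdeal) ^ h := by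
  obtain ⟨k, u, w, hu, hu', hw, hw'⟩ := hF.exists_consecutive
  have hpow : ∀ {j : ℕ} {x : A}, x ∈ F.I j → ∀ i, x ^ i ∈ F.I (i * j) := by
    intro j x hx i
    induction i with
    | zero => rw [zero_mul, F.zero]; trivial
    | succ i ih =>
      rw [pow_succ, Nat.succ_mul]
      exact F.mul _ _ (Ideal.mul_mem_mul ih hx)
  have hB : a * w ^ h ∈ F.I (h * (k + 1)) :=
    F.anti (by rw [mul_add, mul_one, add_comm]) (F.mul _ _ (Ideal.mul_mem_mul ha (hpow hw h)))
  have hU : reesMonomial F (k + 1) u hu ∉ shiftIdeal F 1 :=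
    fun H => hu' ((reesMonomial_mem_shiftIdeal F (ha := hu)).mp H)
  have hW : reesMonomial F k w hw ∉ shiftIdeal F 1 :=
    fun H => hw' ((reesMonomial_mem_shiftIdeal F).mp H)
  have hu0 : u ∈ F.I k := F.anti (Nat.le_succ k) hu
  have hp := shiftIdeal_one_isPrime hF
  let x : HomogeneousLocalization.AtPrime (reesPart F)
      (exceptionalPoint hF).asHomogeneousIdeal.toIdeal :=
    .mk ⟨h * (k + 1), ⟨reesMonomial F _ _ hB, reesMonomial_mem F _ _ hB⟩,
      ⟨reesMonomial F (k + 1) u hu ^ h, by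
        simpa using SetLike.pow_mem_graded h (reesMonomial_mem F (k + 1) u hu)⟩,
      fun H => hU (hp.mem_of_pow_mem _ H)⟩
  let π : HomogeneousLocalization.AtPrime (reesPart F)
      (exceptionalPoint hF).asHomogeneousIdeal.toIdeal :=
    .mk ⟨k, ⟨reesMonomial F k u hu0, reesMonomial_mem F k u hu0⟩,
      ⟨reesMonomial F k w hw, reesMonomial_mem F k w hw⟩, hW⟩
  have hx : fromZeroRingHom (reesPart F) _ (toReesZero F a) = x * π ^ h := by
    apply HomogeneousLocalization.val_injective
    rw [HomogeneousLocalization.val_mul, HomogeneousLocalization.val_pow]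
    change Localization.mk _ 1 = Localization.mk _ _ * Localization.mk _ _ ^ h
    rw [Localization.mk_pow, Localization.mk_mul, Localization.mk_eq_mk_iff,
      Localization.r_iff_exists]
    refine ⟨1, Subtype.ext ?_⟩
    change 1 * (((monomial (k + 1) u) ^ h * (monomial k w) ^ h) * monomial 0 a) =
      1 * (1 * (monomial (h * (k + 1)) (a * w ^ h) * (monomial k u) ^ h))
    simp only [one_mul, monomial_pow, monomial_mul_monomial]
    rw [show (k + 1) * h + k * h + 0 = h * (k + 1) + k * h by ring,
      show u ^ h * w ^ h * a = a * w ^ h * u ^ h by ring]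
  have hπ : π ∈ IsLocalRing.maximalIdeal (HomogeneousLocalization.AtPrime (reesPart F)
      (exceptionalPoint hF).asHomogeneousIdeal.toIdeal) := by
    rw [IsLocalRing.mem_maximalIdeal, mem_nonunits_iff, ← isUnit_iff_isUnit_val]
    change ¬ IsUnit (Localization.mk _ _)
    rw [Localization.mk_eq_mk',
      IsLocalization.AtPrime.isUnit_mk'_iff _ (exceptionalPoint hF).asHomogeneousIdeal.toIdeal]
    exact fun H => H ((reesMonomial_mem_shiftIdeal F (ha := hu0)).mpr hu)
  rw [hx]
  exact Ideal.mul_mem_left _ _ (Ideal.pow_mem_pow hπ h)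

omit hF in
instance isLocalRing_blowup_stalk (y : Proj (reesPart F)) : IsLocalRing ((blowup F).presheaf.stalk y) :=
  (inferInstance : ∀ z : blowup F, IsLocalRing ((blowup F).presheaf.stalk z)) y

/-- The order of the pull-back of a function along the exceptional divisor. -/
theorem stalkMap_mem_maximalIdeal_pow_iff {h : ℕ} {a : A} :
    (blowupMap F).stalkMap (exceptionalPoint hF)
      (specToStalk (blowupMap F (exceptionalPoint hF)) a) ∈
      IsLocalRing.maximalIdeal ((blowup F).presheaf.stalk (exceptionalPoint hF)) ^ h ↔
    a ∈ F.I h := by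
  refine (ringEquiv_mem_maximalIdeal_pow_iff
    (R := (blowup F).presheaf.stalk (exceptionalPoint hF))
    (S := HomogeneousLocalization.AtPrime (reesPart F)
      (exceptionalPoint hF).asHomogeneousIdeal.toIdeal)
    (blowupStalkEquiv F (exceptionalPoint hF))).symm.trans ?_
  rw [blowupStalkEquiv_stalkMap]
  exact ⟨mem_of_fromZeroRingHom_mem hF, fromZeroRingHom_mem_of_mem hF⟩

end LeadingForms

end WMult

namespace WMult

/-! ### The fibre over the centre, the direct image ideals and their colength -/

section Pushforward

variable {A : Type} [CommRing A] {F : IdealFiltration A}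

/-- If `I (k + 1)` is generated by elements `f` with a power `f ^ N` in `I 1 · I (k * N)`, then every
point of the fibre over `x` is a specialization of the exceptional point. -/
theorem shiftIdeal_one_le_of_blowupMap {x : Spec (.of A)} (hx : x.asIdeal = F.I 1)
    (hE : ∀ k, F.I (k + 1) ≤ Ideal.span {f | f ∈ F.I k ∧
      ∃ N : ℕ, ∃ m ∈ F.I 1, ∃ b ∈ F.I (k * N), f ^ N = m * b})
    (y : Proj (reesPart F)) (hy : blowupMap F y = x) :
    shiftIdeal F 1 ≤ y.asHomogeneousIdeal.toIdeal := by
  have key : ∀ k, ∀ a ∈ F.I (k + 1), ∃ ha : a ∈ F.I k,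
      reesMonomial F k a ha ∈ y.asHomogeneousIdeal.toIdeal := by
    intro k a ha
    have h := hE k ha
    clear ha
    induction h using Submodule.span_induction with
    | mem f hf =>
      obtain ⟨hf, N, m, hm, b, hb, h⟩ := hf
      -- $(fT^k)^N=(mT^0)(bT^{kN})$, and $mT^0$ lies in the prime of $y$ because $y$ maps to $x$,
      -- whose ideal is $I_1$.
      refine ⟨hf, Ideal.IsPrime.mem_of_pow_mem (isPrime_toIdeal F y) N ?_⟩
      rw [← hx, ← hy, mem_blowupMap_asIdeal_iff] at hm
      convert! Ideal.mul_mem_right (reesMonomial F (k * N) b hb) _ hm using 1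
      apply Subtype.ext
      change (monomial k f) ^ N = monomial 0 m * monomial (k * N) b
      rw [monomial_pow, monomial_mul_monomial, h, zero_add]
    | zero =>
      refine ⟨Ideal.zero_mem _, ?_⟩
      convert! Ideal.zero_mem _ using 1
      exact Subtype.ext (map_zero _)
    | add f g _ _ hf hg =>
      obtain ⟨hf, hf'⟩ := hf
      obtain ⟨hg, hg'⟩ := hg
      refine ⟨Ideal.add_mem _ hf hg, ?_⟩
      convert! Ideal.add_mem _ hf' hg' using 1
      exact Subtype.ext (map_add _ _ _)
    | smul c f _ hf =>
      obtain ⟨hf, hf'⟩ := hf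
      refine ⟨Ideal.mul_mem_left _ c hf, ?_⟩
      convert! Ideal.mul_mem_left _ ((toReesZero F c : reesPart F 0) : rees F) hf' using 1
      apply Subtype.ext
      change monomial k (c * f) = monomial 0 c * monomial k f
      rw [monomial_mul_monomial, zero_add]
  intro f hf
  classical
  rw [← DirectSum.sum_support_decompose (reesPart F) f]
  refine Ideal.sum_mem _ fun k _ => ?_
  rw [decompose_eq_reesMonomial]
  exact (key k _ (hf k)).2

/-- The exceptional point lies in the fibre and specializes to each of its points, so the fibre is
irreducible. -/
theorem componentPoints_blowupMap (hF : F.IsValuative) {x : Spec (.of A)}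
    (hx : x.asIdeal = F.I 1)
    (hE : ∀ k, F.I (k + 1) ≤ Ideal.span {f | f ∈ F.I k ∧
      ∃ N : ℕ, ∃ m ∈ F.I 1, ∃ b ∈ F.I (k * N), f ^ N = m * b}) :
    componentPoints (blowupMap F ⁻¹' {x}) = {(exceptionalPoint hF : blowup F)} := by
  have hle : ∀ y : ProjectiveSpectrum (reesPart F), blowupMap F y = x →
      (exceptionalPoint hF : ProjectiveSpectrum (reesPart F)) ⤳ y := by
    intro y hy
    exact specializes_iff_mem_closure.mpr ((ProjectiveSpectrum.le_iff_mem_closure _ _ _).mp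
      (shiftIdeal_one_le_of_blowupMap hx hE y hy))
  have hη := blowupMap_exceptionalPoint hF hx
  apply Set.eq_singleton_iff_unique_mem.mpr
  refine ⟨⟨hη, fun y hy hyη => ?_⟩, fun y hy => (hy.2 _ hη (hle y hy.1)).symm⟩
  exact Specializes.antisymm hyη (hle y hy) |>.eq

theorem germ_app_mem_iff (hF : F.IsValuative) {h : ℕ} {x : Spec (.of A)} (hx : x.asIdeal = F.I 1)
    (hE : ∀ k, F.I (k + 1) ≤ Ideal.span {f | f ∈ F.I k ∧
      ∃ N : ℕ, ∃ m ∈ F.I 1, ∃ b ∈ F.I (k * N), f ^ N = m * b})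
    (U : (blowup F).Opens) (s : Γ(blowup F, U)) (hU : (exceptionalPoint hF : blowup F) ∈ U) :
    s ∈ divisorIdeal (blowupMap F ⁻¹' {x}) h U ↔
      (blowup F).presheaf.germ U (exceptionalPoint hF) hU s ∈
        IsLocalRing.maximalIdeal ((blowup F).presheaf.stalk (exceptionalPoint hF)) ^ h := by
  rw [divisorIdeal, componentPoints_blowupMap hF hx hE]
  simp only [Ideal.mem_iInf]
  exact ⟨fun H => H _ rfl hU, fun H η hη hU => by subst hη; exact H⟩

/-- The ideal `μ_* O(-hE)` of the blow-up of a valuative filtration is generated by the `h`-th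
step of the filtration. -/
theorem pushforwardIdeal_blowupMap (hF : F.IsValuative) {x : Spec (.of A)}
    (hx : x.asIdeal = F.I 1)
    (hE : ∀ k, F.I (k + 1) ≤ Ideal.span {f | f ∈ F.I k ∧
      ∃ N : ℕ, ∃ m ∈ F.I 1, ∃ b ∈ F.I (k * N), f ^ N = m * b}) (h : ℕ) :
    pushforwardIdeal (blowupMap F) x h = (F.I h).map (specToStalk x) := by
  obtain rfl := blowupMap_exceptionalPoint hF hx
  apply le_antisymm
  · refine iSup₂_le fun U hU => Ideal.map_le_iff_le_comap.mpr fun s hs => ?_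
    rw [Ideal.mem_comap, germ_app_mem_iff hF hx hE _ _ hU] at hs
    have h1 : (blowupMap F).stalkMap (exceptionalPoint hF)
        ((Spec (.of A)).presheaf.germ U _ hU s) ∈
        IsLocalRing.maximalIdeal ((blowup F).presheaf.stalk (exceptionalPoint hF)) ^ h := by
      rw [Scheme.Hom.germ_stalkMap_apply (blowupMap F) U (exceptionalPoint hF) hU s]
      exact hs
    -- The germ is $a/b$ with $b$ a unit at the point. Multiplying by $b$ reduces the claim to the
    -- global function $a$.
    obtain ⟨a, b, hb, hab⟩ := exists_mul_specToStalk_eq _ ((Spec (.of A)).presheaf.germ U _ hU s)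
    have h2 : a ∈ F.I h := by
      rw [← stalkMap_mem_maximalIdeal_pow_iff hF, ← hab]
      have := Ideal.mul_mem_right ((blowupMap F).stalkMap (exceptionalPoint hF)
        (specToStalk _ b)) _ h1
      exact (map_mul ((blowupMap F).stalkMap (exceptionalPoint hF)).hom _ _).symm ▸ this
    rw [Ideal.mem_comap, ← Ideal.mul_unit_mem_iff_mem _ ((specToStalk_isUnit_iff _ b).mpr hb)]
    exact hab ▸ Ideal.mem_map_of_mem _ h2
  · refine Ideal.map_le_iff_le_comap.mpr fun a ha => ?_
    refine Submodule.mem_iSup_of_mem ⊤ (Submodule.mem_iSup_of_mem trivial ?_)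
    refine Ideal.mem_map_of_mem _ ?_
    rw [Ideal.mem_comap, germ_app_mem_iff hF hx hE (blowupMap F ⁻¹ᵁ ⊤) _ trivial]
    rw [← stalkMap_mem_maximalIdeal_pow_iff hF] at ha
    have h1 := Scheme.Hom.germ_stalkMap_apply (blowupMap F) ⊤ (exceptionalPoint hF) trivial
      ((Scheme.ΓSpecIso (.of A)).inv a)
    exact h1 ▸ ha

/-- If every function that does not vanish at `x` is invertible modulo `I`, then `I` has the same
colength in the stalk at `x` as globally. -/
theorem dimQuotient_map_specToStalk [Algebra ℂ A] (x : Spec (.of A)) (I : Ideal A)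
    (hI : ∀ b ∉ x.asIdeal, IsUnit (Ideal.Quotient.mk I b)) :
    dimQuotient (Spec.map (CommRingCat.ofHom (algebraMap ℂ A))) x (I.map (specToStalk x)) =
      Module.rank ℂ (A ⧸ I) := by
  have hs : scalars (Spec.map (CommRingCat.ofHom (algebraMap ℂ A))) x =
      (specToStalk x).comp (algebraMap ℂ A) := by
    ext c
    have h := congr($(Scheme.ΓSpecIso_inv_naturality (CommRingCat.ofHom (algebraMap ℂ A))) c)
    exact congr((Spec (.of A)).presheaf.germ ⊤ x trivial $h.symm)
  have hinv : ∀ b ∉ x.asIdeal, ∃ c, b * c - 1 ∈ I := by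
    intro b hb
    obtain ⟨c, hc⟩ := (hI b hb).exists_right_inv
    obtain ⟨c, rfl⟩ := Ideal.Quotient.mk_surjective c
    exact ⟨c, Ideal.Quotient.eq.mp (by rw [map_mul, hc, map_one])⟩
  let f : A ⧸ I →+* (Spec (.of A)).presheaf.stalk x ⧸ I.map (specToStalk x) :=
    Ideal.quotientMap _ (specToStalk x) Ideal.le_comap_map
  -- The denominators are already invertible modulo $I$, so localizing $A/I$ changes nothing.
  have hf : Function.Bijective f := by
    constructor
    · rw [injective_iff_map_eq_zero]
      intro a ha
      obtain ⟨a, rfl⟩ := Ideal.Quotient.mk_surjective a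
      rw [Ideal.quotientMap_mk, Ideal.Quotient.eq_zero_iff_mem, mem_map_specToStalk_iff] at ha
      obtain ⟨b, hb, hba⟩ := ha
      rw [← (hI b hb).mul_right_eq_zero, ← map_mul]
      exact Ideal.Quotient.eq_zero_iff_mem.mpr hba
    · intro z
      obtain ⟨z, rfl⟩ := Ideal.Quotient.mk_surjective z
      obtain ⟨a, b, hb, hab⟩ := exists_mul_specToStalk_eq x z
      obtain ⟨c, hc⟩ := hinv b hb
      refine ⟨Ideal.Quotient.mk I (a * c), ?_⟩
      rw [Ideal.quotientMap_mk, Ideal.Quotient.eq, map_mul, ← hab]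
      have := Ideal.mul_mem_left _ z (Ideal.mem_map_of_mem (specToStalk x) hc)
      rwa [map_sub, map_mul, map_one, mul_sub, mul_one, ← mul_assoc] at this
  unfold dimQuotient
  let _ : Module ℂ ((Spec (.of A)).presheaf.stalk x ⧸ I.map (specToStalk x)) :=
    Module.compHom _ ((Ideal.Quotient.mk (I.map (specToStalk x))).comp
      (scalars (Spec.map (CommRingCat.ofHom (algebraMap ℂ A))) x))
  let e : (A ⧸ I) ≃ₗ[ℂ] ((Spec (.of A)).presheaf.stalk x ⧸ I.map (specToStalk x)) :=
    LinearEquiv.ofBijective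
      { toFun := f
        map_add' := map_add f
        map_smul' := fun c z => by
          rw [Algebra.smul_def, map_mul]
          change _ = (Ideal.Quotient.mk (I.map (specToStalk x))) (scalars _ x c) * f z
          rw [hs]
          rfl } hf
  exact e.rank_eq.symm

end Pushforward

end WMult

namespace WMult

/-! ### Invariant monomials and their degrees -/

section Invariants

variable {n r : ℕ} {a : Fin n → ℕ}

theorem act_monomial (ζ : ℂ) (b : Fin n →₀ ℕ) (c : ℂ) :
    act a ζ (MvPolynomial.monomial b c) =
      MvPolynomial.monomial b (ζ ^ Finsupp.weight a b * c) := by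
  rw [act, MvPolynomial.aeval_monomial, MvPolynomial.monomial_eq, Finsupp.weight_apply,
    Finsupp.prod_congr (g2 := fun i k => MvPolynomial.C (ζ ^ (k • a i)) * MvPolynomial.X i ^ k),
    Finsupp.prod_mul]
  · rw [map_mul, mul_comm (MvPolynomial.C _) (MvPolynomial.C c), mul_assoc]
    congr 2
    rw [Finsupp.sum, ← Finset.prod_pow_eq_pow_sum, map_prod]
    rfl
  · intro i _
    rw [mul_pow, ← map_pow, ← pow_mul, smul_eq_mul, mul_comm (a i)]

theorem coeff_act (ζ : ℂ) (b : Fin n →₀ ℕ) (f : MvPolynomial (Fin n) ℂ) :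
    (act a ζ f).coeff b = ζ ^ Finsupp.weight a b * f.coeff b := by
  classical
  induction f using MvPolynomial.induction_on' with
  | monomial u c =>
    rw [act_monomial, MvPolynomial.coeff_monomial, MvPolynomial.coeff_monomial]
    split_ifs with h
    · rw [h]
    · rw [mul_zero]
  | add p q hp hq => rw [map_add, MvPolynomial.coeff_add, hp, hq, MvPolynomial.coeff_add, mul_add]

/-- Monomials are eigenvectors of the action, and one primitive $r$-th root of unity already detects
divisibility of the weight by $r$. -/
theorem mem_invariants_iff (hr : 0 < r) {f : MvPolynomial (Fin n) ℂ} :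
    f ∈ invariants r a ↔ ∀ b ∈ f.support, r ∣ Finsupp.weight a b := by
  constructor
  · intro hf b hb
    have hζ := Complex.isPrimitiveRoot_exp r hr.ne'
    have h := congr(MvPolynomial.coeff b $(hf _ hζ.pow_eq_one))
    rw [coeff_act] at h
    rw [MvPolynomial.mem_support_iff] at hb
    exact (hζ.pow_eq_one_iff_dvd _).mp (mul_right_cancel₀ hb (h.trans (one_mul _).symm))
  · intro hf ζ hζ
    ext b
    rw [coeff_act]
    by_cases hb : b ∈ f.support
    · obtain ⟨k, hk⟩ := hf b hb
      rw [hk, pow_mul, hζ, one_pow, one_mul]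
    · rw [MvPolynomial.notMem_support_iff.mp hb, mul_zero]

theorem monomial_mem_invariants (hr : 0 < r) {b : Fin n →₀ ℕ} (hb : r ∣ Finsupp.weight a b)
    (c : ℂ) : MvPolynomial.monomial b c ∈ invariants r a := by
  rw [mem_invariants_iff hr]
  intro u hu
  rwa [Finset.mem_singleton.mp (MvPolynomial.support_monomial_subset hu)]

variable {l g : ℕ}

theorem natCast_le_weight_iff (hr : 0 < r) (hlg : l * g = r) (k : ℕ) (b : Fin n →₀ ℕ) :
    (k : ℚ≥0) ≤ Finsupp.weight (fun _ : Fin n => (l : ℚ≥0) / (r : ℚ≥0)) b ↔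
      g * k ≤ b.degree := by
  have hl : 0 < l := Nat.pos_of_ne_zero (by rintro rfl; omega)
  have h1 : Finsupp.weight (fun _ : Fin n => (l : ℚ≥0) / (r : ℚ≥0)) b =
      (b.degree : ℚ≥0) * ((l : ℚ≥0) / (r : ℚ≥0)) := by
    rw [Finsupp.weight_eq_sum, Finsupp.degree_eq_sum, Nat.cast_sum, Finset.sum_mul]
    simp
  have hr' : (0 : ℚ≥0) < r := by exact_mod_cast hr
  rw [h1, ← mul_div_assoc, le_div_iff₀ hr', ← hlg]
  norm_cast
  rw [show k * (l * g) = (g * k) * l by ring]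
  exact Nat.mul_le_mul_right_iff hl

/-- From $la_j\equiv l$ one gets $l\cdot$weight $\equiv l\cdot$degree modulo $r=lg$. Cancel $l$. -/
theorem dvd_degree_of_dvd_weight (hr : 0 < r) (hlg : l * g = r)
    (hl : ∀ j, a j * l ≡ l [MOD r]) {b : Fin n →₀ ℕ} (hb : r ∣ Finsupp.weight a b) :
    g ∣ b.degree := by
  have hl0 : 0 < l := Nat.pos_of_ne_zero (by rintro rfl; omega)
  have h1 : (r : ℤ) ∣ (l : ℤ) * Finsupp.weight a b - l * b.degree := by
    rw [Finsupp.weight_eq_sum, Finsupp.degree_eq_sum, Nat.cast_sum, Nat.cast_sum, ← mul_sub,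
      ← Finset.sum_sub_distrib, Finset.mul_sum]
    refine Finset.dvd_sum fun i _ => ?_
    have := (Nat.modEq_iff_dvd.mp (hl i).symm).mul_left (b i : ℤ)
    convert! this using 1
    simp only [smul_eq_mul]
    push_cast
    ring
  have h2 : (r : ℤ) ∣ (l : ℤ) * Finsupp.weight a b :=
    Dvd.dvd.mul_left (Int.natCast_dvd_natCast.mpr hb) _
  have h3 := (dvd_sub_right h2).mp h1
  norm_cast at h3
  rw [← hlg] at h3
  exact Nat.dvd_of_mul_dvd_mul_left hl0 h3

/-- The degrees of invariant monomials generate the group `gℤ`. -/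
theorem exists_consecutive_degrees (hr : 0 < r) (hlg : l * g = r)
    (hl : ∀ j, a j * l ≡ l [MOD r])
    (hmin : ∀ i, 0 < i → i ≤ r → (∀ j, a j * i ≡ i [MOD r]) → l ≤ i)
    {i₀ : Fin n} (h0 : a i₀ = 1) :
    ∃ (k : ℕ) (b b' : Fin n →₀ ℕ), r ∣ Finsupp.weight a b ∧ r ∣ Finsupp.weight a b' ∧
      b.degree = g * (k + 1) ∧ b'.degree = g * k := by
  let H : AddSubgroup ℤ :=
    { carrier := {z | ∃ b b' : Fin n →₀ ℕ, r ∣ Finsupp.weight a b ∧ r ∣ Finsupp.weight a b' ∧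
        z = b.degree - b'.degree}
      zero_mem' := ⟨0, 0, by simp⟩
      add_mem' := by
        rintro _ _ ⟨b, b', hb, hb', rfl⟩ ⟨c, c', hc, hc', rfl⟩
        refine ⟨b + c, b' + c', ?_, ?_, ?_⟩
        · rw [map_add]; exact dvd_add hb hc
        · rw [map_add]; exact dvd_add hb' hc'
        · rw [map_add, map_add]; push_cast; ring
      neg_mem' := by
        rintro _ ⟨b, b', hb, hb', rfl⟩
        exact ⟨b', b, hb', hb, by ring⟩ }
  obtain ⟨d, hd⟩ := Int.subgroup_cyclic H
  have hH : ∀ z ∈ H, d ∣ z := by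
    intro z hz
    rw [hd, AddSubgroup.mem_closure_singleton] at hz
    obtain ⟨m, rfl⟩ := hz
    exact ⟨m, by rw [smul_eq_mul, mul_comm]⟩
  -- The invariant monomial used is $x_{i_0}^r$.
  have hdr : d ∣ r := hH _ ⟨Finsupp.single i₀ r, 0, by simp [Finsupp.weight_single], by simp,
    by simp [Finsupp.degree_single]⟩
  have hda : ∀ j, d ∣ (a j : ℤ) - 1 := by
    intro j
    have h1 : d ∣ ((1 + (r * a j - a j) : ℕ) : ℤ) := by
      -- $x_jx_{i_0}^{ra_j-a_j}$ has weight $ra_j$, and its degree is $1-a_j$ modulo $d$, since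
      -- $d\mid r$.
      refine hH _ ⟨Finsupp.single j 1 + Finsupp.single i₀ (r * a j - a j), 0, ?_, by simp, ?_⟩
      · rw [map_add, Finsupp.weight_single, Finsupp.weight_single, h0]
        have : a j ≤ r * a j := Nat.le_mul_of_pos_left _ hr
        simp only [smul_eq_mul, one_mul, mul_one]
        rw [Nat.add_sub_cancel' this]
        exact dvd_mul_right _ _
      · rw [map_add, Finsupp.degree_single, Finsupp.degree_single, map_zero, Nat.cast_zero,
          sub_zero]
    rw [Nat.cast_add, Nat.cast_sub (Nat.le_mul_of_pos_left _ hr)] at h1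
    push_cast at h1
    have h2 : d ∣ (r : ℤ) * a j := hdr.mul_right _
    have h3 := dvd_sub h2 h1
    convert! h3 using 1
    ring
  obtain ⟨e, he⟩ : ∃ e : ℕ, r = e * d.natAbs := by
    obtain ⟨e, he⟩ := Int.natCast_dvd_natCast.mp (Int.natAbs_dvd.mpr hdr)
    exact ⟨e, by rw [mul_comm, ← he]⟩
  have he0 : 0 < e := Nat.pos_of_ne_zero (by rintro rfl; omega)
  have hd0 : 0 < d.natAbs := Nat.pos_of_ne_zero (by intro h; rw [h] at he; omega)
  -- As $d$ divides every $a_j-1$, the integer $e=r/|d|$ satisfies the congruences that define $l$.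
  -- Minimality gives $l\le e$, hence $|d|\le g$.
  have hle : l ≤ e := by
    refine hmin e he0 (he ▸ Nat.le_mul_of_pos_right _ hd0) fun j => ?_
    refine (Nat.modEq_iff_dvd.mpr ?_).symm
    rw [he]
    push_cast
    have := mul_dvd_mul_left (e : ℤ) ((abs_dvd _ _).mpr (hda j))
    convert! this using 1
    ring
  have hdg : d.natAbs ≤ g := by
    by_contra! h
    have h1 : l * g < e * d.natAbs := Nat.mul_lt_mul_of_le_of_lt hle h he0
    omega
  have hgH : (g : ℤ) ∈ H := by
    have hgd : (g : ℤ) ∣ d := by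
      obtain ⟨b, b', hb, hb', h⟩ : d ∈ H := hd ▸ AddSubgroup.mem_closure_singleton_self d
      rw [h]
      exact dvd_sub (Int.natCast_dvd_natCast.mpr (dvd_degree_of_dvd_weight hr hlg hl hb))
        (Int.natCast_dvd_natCast.mpr (dvd_degree_of_dvd_weight hr hlg hl hb'))
    have h1 : d.natAbs = g := le_antisymm hdg (Nat.le_of_dvd hd0 (Int.natCast_dvd.mp hgd))
    have h2 : d ∈ H := hd ▸ AddSubgroup.mem_closure_singleton_self d
    rw [← h1, Int.natCast_natAbs]
    rcases abs_choice d with h | h <;> rw [h]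
    · exact h2
    · exact neg_mem h2
  obtain ⟨b, b', hb, hb', h⟩ := hgH
  obtain ⟨k, hk⟩ := dvd_degree_of_dvd_weight hr hlg hl hb'
  refine ⟨k, b, b', hb, hb', ?_, hk⟩
  rw [mul_add, mul_one, ← hk]
  omega

end Invariants

/-! ### The weight filtration on the invariant ring -/

section WeightFiltration

variable {n r : ℕ} {a : Fin n → ℕ} {l g : ℕ}

theorem mem_weightFiltration_iff (hr : 0 < r) (hlg : l * g = r) {k : ℕ} {f : invariants r a} :
    f ∈ (weightFiltration r a fun _ => (l : ℚ≥0) / (r : ℚ≥0)).I k ↔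
      ∀ b ∈ (f : MvPolynomial (Fin n) ℂ).support, g * k ≤ b.degree := by
  change (∀ b ∈ (f : MvPolynomial (Fin n) ℂ).support, (k : ℚ≥0) ≤ Finsupp.weight _ b) ↔ _
  simp only [natCast_le_weight_iff hr hlg]

/-- Passing to power series gives access to the additivity of the order on products. -/
theorem mem_weightFiltration_iff_order (hr : 0 < r) (hlg : l * g = r) {k : ℕ}
    {f : invariants r a} :
    f ∈ (weightFiltration r a fun _ => (l : ℚ≥0) / (r : ℚ≥0)).I k ↔
      ((g * k : ℕ) : ℕ∞) ≤
        ((f : MvPolynomial (Fin n) ℂ) : MvPowerSeries (Fin n) ℂ).order := by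
  rw [mem_weightFiltration_iff hr hlg]
  constructor
  · intro h
    refine MvPowerSeries.nat_le_order fun d hd => ?_
    rw [MvPolynomial.coeff_coe]
    by_contra hne
    exact absurd (h d (MvPolynomial.mem_support_iff.mpr hne)) (by omega)
  · intro h b hb
    rw [MvPolynomial.mem_support_iff, ← MvPolynomial.coeff_coe] at hb
    exact_mod_cast h.trans (MvPowerSeries.order_le hb)

theorem exists_order_eq (hr : 0 < r) (hlg : l * g = r) (hl : ∀ j, a j * l ≡ l [MOD r])
    {f : invariants r a} (hf : f ≠ 0) : ∃ m : ℕ,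
      ((f : MvPolynomial (Fin n) ℂ) : MvPowerSeries (Fin n) ℂ).order = ((g * m : ℕ) : ℕ∞) := by
  have h1 : ((f : MvPolynomial (Fin n) ℂ) : MvPowerSeries (Fin n) ℂ) ≠ 0 := by
    intro h
    exact hf (Subtype.ext (MvPolynomial.coe_injective _ _ (h.trans MvPolynomial.coe_zero.symm)))
  obtain ⟨b, hb, h2⟩ := MvPowerSeries.exists_coeff_ne_zero_and_order
    (MvPowerSeries.ne_zero_iff_order_finite.mp h1)
  rw [MvPolynomial.coeff_coe, ← MvPolynomial.mem_support_iff] at hb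
  obtain ⟨m, hm⟩ := dvd_degree_of_dvd_weight hr hlg hl ((mem_invariants_iff hr).mp f.2 b hb)
  exact ⟨m, by rw [← hm, h2]⟩

theorem monomial_mem_weightFiltration_iff (hr : 0 < r) (hlg : l * g = r) {b : Fin n →₀ ℕ} {c : ℂ}
    (hc : c ≠ 0) (hb : r ∣ Finsupp.weight a b) {k : ℕ} :
    (⟨MvPolynomial.monomial b c, monomial_mem_invariants hr hb c⟩ : invariants r a) ∈
      (weightFiltration r a fun _ => (l : ℚ≥0) / (r : ℚ≥0)).I k ↔ g * k ≤ b.degree := by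
  classical
  rw [mem_weightFiltration_iff hr hlg]
  simp [MvPolynomial.support_monomial, hc]

/-- Orders add, and those of nonzero invariants are multiples of $g$. This integrality turns
$m+m'\ge j+k+1$ into $m\ge j+1$ or $m'\ge k+1$. -/
theorem weightFiltration_isValuative (hr : 0 < r) (hlg : l * g = r)
    (hl : ∀ j, a j * l ≡ l [MOD r])
    (hmin : ∀ i, 0 < i → i ≤ r → (∀ j, a j * i ≡ i [MOD r]) → l ≤ i)
    {i₀ : Fin n} (h0 : a i₀ = 1) :
    (weightFiltration r a fun _ => (l : ℚ≥0) / (r : ℚ≥0)).IsValuative where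
  ne_top h := by
    rw [Ideal.eq_top_iff_one, mem_weightFiltration_iff hr hlg] at h
    have h1 := h 0 (by simp)
    have : g ≠ 0 := by rintro rfl; omega
    simp [this] at h1
  mem_or_mem {j k f h} hf hh hfh := by
    rcases eq_or_ne f 0 with rfl | hf0
    · exact Or.inl (Ideal.zero_mem _)
    rcases eq_or_ne h 0 with rfl | hh0
    · exact Or.inr (Ideal.zero_mem _)
    have hg : 0 < g := Nat.pos_of_ne_zero (by rintro rfl; omega)
    obtain ⟨m, hm⟩ := exists_order_eq hr hlg hl hf0
    obtain ⟨m', hm'⟩ := exists_order_eq hr hlg hl hh0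
    simp only [mem_weightFiltration_iff_order hr hlg, MulMemClass.coe_mul, MvPolynomial.coe_mul,
      MvPowerSeries.order_mul, hm, hm'] at hf hh hfh ⊢
    norm_cast at hf hh hfh ⊢
    rw [← mul_add] at hfh
    rw [Nat.mul_le_mul_left_iff hg] at hf hh hfh ⊢
    rw [Nat.mul_le_mul_left_iff hg]
    omega
  exists_consecutive := by
    have hg : 0 < g := Nat.pos_of_ne_zero (by rintro rfl; omega)
    obtain ⟨k, b, b', hb, hb', h1, h2⟩ := exists_consecutive_degrees hr hlg hl hmin h0
    refine ⟨k, _, _, (monomial_mem_weightFiltration_iff hr hlg one_ne_zero hb).mpr h1.ge,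
      fun H => ?_, (monomial_mem_weightFiltration_iff hr hlg one_ne_zero hb').mpr h2.ge,
      fun H => ?_⟩
    · rw [monomial_mem_weightFiltration_iff hr hlg one_ne_zero hb, h1,
        Nat.mul_le_mul_left_iff hg] at H
      omega
    · rw [monomial_mem_weightFiltration_iff hr hlg one_ne_zero hb', h2,
        Nat.mul_le_mul_left_iff hg] at H
      omega

theorem eq_sum_monomial (hr : 0 < r) (f : invariants r a) :
    f = ∑ b ∈ (f : MvPolynomial (Fin n) ℂ).support.attach,
      ⟨MvPolynomial.monomial b.1 ((f : MvPolynomial (Fin n) ℂ).coeff b),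
        monomial_mem_invariants hr ((mem_invariants_iff hr).mp f.2 b b.2) _⟩ := by
  apply Subtype.ext
  rw [AddSubmonoidClass.coe_finsetSum]
  conv_lhs => rw [(f : MvPolynomial (Fin n) ℂ).as_sum]
  exact (Finset.sum_attach _ (fun b => MvPolynomial.monomial b
    ((f : MvPolynomial (Fin n) ℂ).coeff b))).symm

/-- Every monomial term of an invariant is invariant. If $x_i$ divides the term $cx^b$, its $r$-th
power is $x_i^r$ times an invariant monomial. The first factor has degree $r=lg\ge g$; the second
has degree at least $rg(k+1)-r\ge gkr$. -/
theorem weightFiltration_succ_le_span (hr : 0 < r) (hlg : l * g = r) (k : ℕ) :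
    (weightFiltration r a fun _ => (l : ℚ≥0) / (r : ℚ≥0)).I (k + 1) ≤
      Ideal.span {f | f ∈ (weightFiltration r a fun _ => (l : ℚ≥0) / (r : ℚ≥0)).I k ∧
        ∃ N : ℕ, ∃ m ∈ (weightFiltration r a fun _ => (l : ℚ≥0) / (r : ℚ≥0)).I 1,
        ∃ b ∈ (weightFiltration r a fun _ => (l : ℚ≥0) / (r : ℚ≥0)).I (k * N),
          f ^ N = m * b} := by
  have hg : 0 < g := Nat.pos_of_ne_zero (by rintro rfl; omega)
  have hl0 : 0 < l := Nat.pos_of_ne_zero (by rintro rfl; omega)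
  intro f hf
  rw [eq_sum_monomial hr f]
  refine Ideal.sum_mem _ fun b _ => Ideal.subset_span ?_
  have hc := MvPolynomial.mem_support_iff.mp b.2
  have hb := (mem_invariants_iff hr).mp f.2 b b.2
  have hdeg := (mem_weightFiltration_iff hr hlg).mp hf b b.2
  rw [mul_add, mul_one] at hdeg
  refine ⟨(monomial_mem_weightFiltration_iff hr hlg hc hb).mpr (by omega), r, ?_⟩
  obtain ⟨i, hi⟩ : ∃ i, b.1 i ≠ 0 := by
    by_contra! H
    have : b.1 = 0 := Finsupp.ext H
    rw [this, map_zero] at hdeg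
    omega
  have hri : r ∣ Finsupp.weight a (Finsupp.single i r) := by
    rw [Finsupp.weight_single]
    exact dvd_mul_right _ _
  have hsplit : r • b.1 = Finsupp.single i r + r • (b.1 - Finsupp.single i 1) := by
    ext j
    by_cases hj : i = j
    · subst hj
      simp only [Finsupp.smul_apply, smul_eq_mul, Finsupp.add_apply, Finsupp.single_eq_same,
        Finsupp.tsub_apply]
      obtain ⟨m, hm⟩ := Nat.exists_eq_succ_of_ne_zero hi
      rw [hm]
      simp [mul_add, add_comm]
    · simp [hj]
  have hrb : r ∣ Finsupp.weight a (r • (b.1 - Finsupp.single i 1)) := by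
    rw [map_nsmul]
    exact dvd_mul_right _ _
  refine ⟨_, (monomial_mem_weightFiltration_iff hr hlg one_ne_zero hri).mpr ?_, _,
    (monomial_mem_weightFiltration_iff hr hlg (pow_ne_zero r hc) hrb).mpr ?_, ?_⟩
  · rw [Finsupp.degree_single, mul_one, ← hlg]
    exact Nat.le_mul_of_pos_left _ hl0
  · have h1 := congr(Finsupp.degree $hsplit)
    rw [map_add, Finsupp.degree_single, map_nsmul, smul_eq_mul] at h1
    have h2 : r * (g * k + g) ≤ r * b.1.degree := Nat.mul_le_mul_left r hdeg
    have h3 : r ≤ r * g := Nat.le_mul_of_pos_right _ hg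
    have h4 : r * (g * k + g) = g * (k * r) + r * g := by ring
    omega
  · apply Subtype.ext
    change (MvPolynomial.monomial b.1 _) ^ r = MvPolynomial.monomial _ _ * MvPolynomial.monomial _ _
    rw [MvPolynomial.monomial_pow, MvPolynomial.monomial_mul, one_mul, hsplit]

/-- Invariant monomials have no degrees strictly between $0$ and $g$. -/
theorem constantCoeff_eq_zero_iff_mem (hr : 0 < r) (hlg : l * g = r)
    (hl : ∀ j, a j * l ≡ l [MOD r]) {f : invariants r a} :
    MvPolynomial.constantCoeff (f : MvPolynomial (Fin n) ℂ) = 0 ↔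
      f ∈ (weightFiltration r a fun _ => (l : ℚ≥0) / (r : ℚ≥0)).I 1 := by
  have hg : 0 < g := Nat.pos_of_ne_zero (by rintro rfl; omega)
  rw [mem_weightFiltration_iff hr hlg]
  constructor
  · intro h b hb
    rw [mul_one]
    refine Nat.le_of_dvd (Nat.pos_of_ne_zero fun h0 => ?_)
      (dvd_degree_of_dvd_weight hr hlg hl ((mem_invariants_iff hr).mp f.2 b hb))
    rw [Finsupp.degree_eq_zero_iff] at h0
    rw [MvPolynomial.mem_support_iff, h0] at hb
    exact hb h
  · intro h
    by_contra hne
    have := h 0 (MvPolynomial.mem_support_iff.mpr hne)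
    rw [map_zero] at this
    omega

theorem origin_asIdeal (hr : 0 < r) (hlg : l * g = r) (hl : ∀ j, a j * l ≡ l [MOD r]) :
    (origin r a).asIdeal = (weightFiltration r a fun _ => (l : ℚ≥0) / (r : ℚ≥0)).I 1 := by
  ext f
  rw [← constantCoeff_eq_zero_iff_mem hr hlg hl]
  rfl

/-- Modulo $I_h$ such an $f$ is a nonzero scalar plus an element of $I_1$, which is nilpotent since
$I_1^h\subseteq I_h$. -/
theorem isUnit_mk_of_notMem (hr : 0 < r) (hlg : l * g = r) (hl : ∀ j, a j * l ≡ l [MOD r])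
    (h : ℕ) {f : invariants r a}
    (hf : f ∉ (weightFiltration r a fun _ => (l : ℚ≥0) / (r : ℚ≥0)).I 1) :
    IsUnit (Ideal.Quotient.mk
      ((weightFiltration r a fun _ => (l : ℚ≥0) / (r : ℚ≥0)).I h) f) := by
  rw [← constantCoeff_eq_zero_iff_mem hr hlg hl] at hf
  set F := weightFiltration r a fun _ => (l : ℚ≥0) / (r : ℚ≥0) with hF
  set c := algebraMap ℂ (invariants r a)
    (MvPolynomial.constantCoeff (f : MvPolynomial (Fin n) ℂ)) with hc
  have hy : f - c ∈ F.I 1 := by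
    rw [hF, ← constantCoeff_eq_zero_iff_mem hr hlg hl]
    change MvPolynomial.constantCoeff ((f : MvPolynomial (Fin n) ℂ) - MvPolynomial.C _) = 0
    rw [map_sub, MvPolynomial.constantCoeff_C, sub_self]
  have hpow : ∀ i, (f - c) ^ i ∈ F.I i := by
    intro i
    induction i with
    | zero => rw [F.zero]; trivial
    | succ i ih =>
      rw [pow_succ]
      exact F.mul _ _ (Ideal.mul_mem_mul ih hy)
  have hnil : IsNilpotent (Ideal.Quotient.mk (F.I h) (f - c)) :=
    ⟨h, by rw [← map_pow]; exact Ideal.Quotient.eq_zero_iff_mem.mpr (hpow h)⟩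
  have hu : IsUnit (Ideal.Quotient.mk (F.I h) c) :=
    ((IsUnit.mk0 _ hf).map (algebraMap ℂ (invariants r a))).map _
  have := hnil.isUnit_add_left_of_commute hu (Commute.all _ _)
  rwa [← map_add, add_sub_cancel] at this

/-- The exponents of the invariant monomials of degree less than `D`. -/
def invariantExponents (r : ℕ) (a : Fin n → ℕ) (D : ℕ) : Set (Fin n →₀ ℕ) :=
  {b | b.degree < D ∧ r ∣ Finsupp.weight a b}

theorem finite_invariantExponents (D : ℕ) : (invariantExponents r a D).Finite :=
  (Finsupp.finite_of_degree_lt D).subset fun _ hb => hb.1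

/-- The coefficients at invariant monomials of degree below $gh$ give a surjection onto a finite
coordinate space with kernel $I_h$. -/
theorem rank_quotient_weightFiltration (hr : 0 < r) (hlg : l * g = r) (h : ℕ) :
    Module.rank ℂ (invariants r a ⧸
      (weightFiltration r a fun _ => (l : ℚ≥0) / (r : ℚ≥0)).I h) =
      (invariantExponents r a (g * h)).ncard := by
  classical
  set J := (weightFiltration r a fun _ => (l : ℚ≥0) / (r : ℚ≥0)).I h with hJ
  have := (finite_invariantExponents (r := r) (a := a) (g * h)).fintype
  let φ : invariants r a →ₗ[ℂ] (invariantExponents r a (g * h) → ℂ) :=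
    LinearMap.pi fun b => (MvPolynomial.lcoeff ℂ b.1).comp (invariants r a).val.toLinearMap
  have hφ : ∀ f b, φ f b = (f : MvPolynomial (Fin n) ℂ).coeff b.1 := fun _ _ => rfl
  have hker : LinearMap.ker φ = J.restrictScalars ℂ := by
    ext f
    rw [LinearMap.mem_ker, Submodule.restrictScalars_mem, hJ, mem_weightFiltration_iff hr hlg]
    constructor
    · intro hf b hb
      by_contra! hlt
      exact MvPolynomial.mem_support_iff.mp hb
        (congr_fun hf ⟨b, hlt, (mem_invariants_iff hr).mp f.2 b hb⟩)
    · intro hf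
      ext b
      rw [hφ, Pi.zero_apply, ← MvPolynomial.notMem_support_iff]
      intro hb
      exact absurd (hf b.1 hb) (not_le.mpr b.2.1)
  have hsurj : Function.Surjective φ := by
    intro v
    have hb (b : invariantExponents r a (g * h)) : r ∣ Finsupp.weight a b.1 := b.2.2
    refine ⟨∑ b : invariantExponents r a (g * h),
      (⟨MvPolynomial.monomial b.1 (v b), monomial_mem_invariants hr (hb b) _⟩ :
        invariants r a), ?_⟩
    ext b
    rw [hφ, AddSubmonoidClass.coe_finsetSum, MvPolynomial.coeff_sum,
      Finset.sum_eq_single b]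
    · simp
    · intro c _ hcb
      rw [MvPolynomial.coeff_monomial, if_neg (fun H => hcb (Subtype.ext H))]
    · intro H
      exact absurd (Finset.mem_univ b) H
  let e : (invariants r a ⧸ J) ≃ₗ[ℂ] (invariantExponents r a (g * h) → ℂ) :=
    (Submodule.Quotient.restrictScalarsEquiv ℂ J).symm.trans
      ((Submodule.quotEquivOfEq _ _ hker.symm).trans (φ.quotKerEquivOfSurjective hsurj))
  rw [e.rank_eq, rank_fun', ← Nat.card_coe_set_eq, Nat.card_eq_fintype_card]

end WeightFiltration

end WMult

namespace WMult

/-! ### Asymptotic count of invariant monomials -/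

section Counting

variable {n r : ℕ} {a : Fin n → ℕ}

/-- Adding the monomials of degree exactly $D+1$ is the Pascal recursion for `Nat.multichoose`. -/
theorem ncard_degree_lt_succ (n D : ℕ) :
    {b : Fin n →₀ ℕ | b.degree < D + 1}.ncard = (n + 1).multichoose D := by
  classical
  induction D with
  | zero =>
    have : {b : Fin n →₀ ℕ | b.degree < 0 + 1} = {0} := by
      ext b
      simp [Finsupp.degree_eq_zero_iff]
    rw [this, Set.ncard_singleton, Nat.multichoose_zero_right]
  | succ D ih =>
    have h : {b : Fin n →₀ ℕ | b.degree < D + 1 + 1} = {b : Fin n →₀ ℕ | b.degree < D + 1} ∪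
        ((Finset.univ : Finset (Fin n)).finsuppAntidiag (D + 1) : Set (Fin n →₀ ℕ)) := by
      ext b
      simp only [Set.mem_ofPred_eq, Set.mem_union, Finset.mem_coe, Finset.mem_finsuppAntidiag,
        Finset.subset_univ, and_true, ← Finsupp.degree_eq_sum]
      omega
    rw [h, Set.ncard_union_eq _ (Finsupp.finite_of_degree_lt _) (Finset.finite_toSet _), ih,
      Set.ncard_coe_finset, Finset.card_finsuppAntidiag_nat_eq_multichoose,
      Finset.card_univ, Fintype.card_fin, Nat.multichoose_succ_succ, add_comm]
    rw [Set.disjoint_left]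
    intro b hb hb'
    simp only [Finset.mem_coe, Finset.mem_finsuppAntidiag, Finset.subset_univ, and_true,
      ← Finsupp.degree_eq_sum] at hb'
    simp only [Set.mem_ofPred_eq] at hb
    omega

theorem factorial_mul_ncard_degree_lt_succ (n D : ℕ) :
    n.factorial * {b : Fin n →₀ ℕ | b.degree < D + 1}.ncard = (D + 1).ascFactorial n := by
  rw [ncard_degree_lt_succ, Nat.multichoose_eq, Nat.ascFactorial_eq_factorial_mul_choose]
  congr 1
  rw [show n + 1 + D - 1 = D + n by omega, Nat.choose_symm_add]

theorem pow_le_factorial_mul_ncard (hn : n ≠ 0) (D : ℕ) :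
    D ^ n ≤ n.factorial * {b : Fin n →₀ ℕ | b.degree < D}.ncard := by
  obtain _ | D := D
  · rw [zero_pow hn]; exact Nat.zero_le _
  · rw [factorial_mul_ncard_degree_lt_succ]
    exact Nat.pow_succ_le_ascFactorial (D + 1) n

theorem factorial_mul_ncard_le_pow (D : ℕ) :
    n.factorial * {b : Fin n →₀ ℕ | b.degree < D}.ncard ≤ (D + n) ^ n := by
  obtain _ | D := D
  · simp
  · rw [factorial_mul_ncard_degree_lt_succ]
    exact (Nat.ascFactorial_le_pow_add D n).trans (Nat.pow_le_pow_left (by omega) n)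

/-- Multiply an invariant monomial by $x_{i_0}^i$ with $0\le i<r$. The weight of the product modulo
$r$ recovers $i$, so the map is injective. -/
theorem mul_ncard_invariantExponents_le {i₀ : Fin n} (h0 : a i₀ = 1) (D : ℕ) :
    r * (invariantExponents r a D).ncard ≤ {b : Fin n →₀ ℕ | b.degree < D + r}.ncard := by
  have hfin : Finite {b : Fin n →₀ ℕ | b.degree < D + r} := Finsupp.finite_of_degree_lt _
  let φ : Fin r × invariantExponents r a D → {b : Fin n →₀ ℕ | b.degree < D + r} := fun p =>
    ⟨p.2.1 + Finsupp.single i₀ p.1.1, by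
      have h1 : p.2.1.degree < D := p.2.2.1
      have h2 := p.1.2
      change Finsupp.degree (p.2.1 + _) < _
      rw [map_add, Finsupp.degree_single]
      omega⟩
  have hφ : Function.Injective φ := by
    intro p q hpq
    have h1 : p.2.1 + Finsupp.single i₀ p.1.1 = q.2.1 + Finsupp.single i₀ q.1.1 :=
      congr_arg Subtype.val hpq
    have h2 := congr(Finsupp.weight a $h1 % r)
    have h3 : r ∣ Finsupp.weight a p.2.1 := p.2.2.2
    have h4 : r ∣ Finsupp.weight a q.2.1 := q.2.2.2
    rw [map_add, map_add, Finsupp.weight_single, Finsupp.weight_single, h0, smul_eq_mul, mul_one,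
      smul_eq_mul, mul_one, Nat.add_mod, Nat.mod_eq_zero_of_dvd h3, zero_add, Nat.mod_mod,
      Nat.add_mod, Nat.mod_eq_zero_of_dvd h4, zero_add, Nat.mod_mod, Nat.mod_eq_of_lt p.1.2,
      Nat.mod_eq_of_lt q.1.2] at h2
    rw [h2] at h1
    exact Prod.ext (Fin.ext h2) (Subtype.ext (add_right_cancel h1))
  have h := Nat.card_le_card_of_injective φ hφ
  rwa [Nat.card_prod, Nat.card_fin, Nat.card_coe_set_eq, Nat.card_coe_set_eq] at h

/-- A power of $x_{i_0}$ with exponent between $1$ and $r$ makes any monomial invariant. Recording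
the residue of the original weight makes the map injective. -/
theorem ncard_le_mul_ncard_invariantExponents (hr : 0 < r) {i₀ : Fin n} (h0 : a i₀ = 1) (D : ℕ) :
    {b : Fin n →₀ ℕ | b.degree < D}.ncard ≤ r * (invariantExponents r a (D + r)).ncard := by
  have hfin : Finite (invariantExponents r a (D + r)) := finite_invariantExponents _
  let φ : {b : Fin n →₀ ℕ | b.degree < D} → Fin r × invariantExponents r a (D + r) := fun b =>
    (⟨Finsupp.weight a b.1 % r, Nat.mod_lt _ hr⟩,
      ⟨b.1 + Finsupp.single i₀ (r - Finsupp.weight a b.1 % r), by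
        have h1 : b.1.degree < D := b.2
        constructor
        · rw [map_add, Finsupp.degree_single]
          omega
        · rw [map_add, Finsupp.weight_single, h0, smul_eq_mul, mul_one]
          have h2 := Nat.div_add_mod (Finsupp.weight a b.1) r
          have h3 := Nat.mod_lt (Finsupp.weight a b.1) hr
          refine ⟨Finsupp.weight a b.1 / r + 1, ?_⟩
          rw [mul_add, mul_one]
          omega⟩)
  have hφ : Function.Injective φ := by
    intro b c hbc
    have h1 : Finsupp.weight a b.1 % r = Finsupp.weight a c.1 % r :=
      congr_arg (fun p => (p.1 : ℕ)) hbc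
    have h2 : b.1 + Finsupp.single i₀ (r - Finsupp.weight a b.1 % r) =
      c.1 + Finsupp.single i₀ (r - Finsupp.weight a c.1 % r) :=
      congr_arg (fun p => (p.2 : Fin n →₀ ℕ)) hbc
    rw [h1] at h2
    exact Subtype.ext (add_right_cancel h2)
  have h := Nat.card_le_card_of_injective φ hφ
  rwa [Nat.card_prod, Nat.card_fin, Nat.card_coe_set_eq, Nat.card_coe_set_eq] at h

theorem abs_pow_sub_pow_le_mul (g K x : ℝ) (hg : 0 ≤ g) (hx : 1 ≤ x) (n : ℕ) :
    |(g * x + K) ^ n - (g * x) ^ n| ≤ |K| * n * (g + |K|) ^ (n - 1) * x ^ (n - 1) := by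
  refine (abs_pow_sub_pow_le _ _ n).trans ?_
  rw [add_sub_cancel_left, mul_assoc (|K| * n), ← mul_pow]
  gcongr
  have h1 : |g * x| = g * x := abs_of_nonneg (by positivity)
  have h2 : |K| ≤ |K| * x := le_mul_of_one_le_right (abs_nonneg K) hx
  rw [add_mul]
  refine max_le ((abs_add_le _ _).trans ?_) ?_ <;> rw [h1]
  · linarith
  · linarith [abs_nonneg K]

theorem isBigO_pow_sub_pow (g K : ℝ) (hg : 0 ≤ g) (n : ℕ) :
    (fun h : ℕ => (g * h + K) ^ n - (g * h) ^ n) =O[Filter.atTop] fun h : ℕ => (h : ℝ) ^ (n - 1) := by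
  refine Asymptotics.IsBigO.of_bound (|K| * n * (g + |K|) ^ (n - 1)) ?_
  filter_upwards [Filter.eventually_ge_atTop 1] with h hh
  rw [Real.norm_eq_abs, Real.norm_eq_abs, abs_of_nonneg (by positivity : (0 : ℝ) ≤ (h : ℝ) ^ _)]
  exact abs_pow_sub_pow_le_mul g K h hg (by exact_mod_cast hh) n

/-- The number of invariant monomials of degree less than `gh`. -/
theorem isBigO_ncard_invariantExponents (hn : n ≠ 0) (hr : 0 < r) {i₀ : Fin n} (h0 : a i₀ = 1)
    {g : ℕ} (hg : 0 < g) :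
    (fun h : ℕ => ((invariantExponents r a (g * h)).ncard : ℝ) -
      ((g : ℝ) * h) ^ n / (r * n.factorial)) =O[Filter.atTop] fun h : ℕ => (h : ℝ) ^ (n - 1) := by
  -- With $c$ the count, $n!\,rc$ lies between $(gh-r)^n$ and $(gh+r+n)^n$, and both differ from
  -- $(gh)^n$ by $O(h^{n-1})$.
  have h1 := (isBigO_pow_sub_pow g (r + n) (Nat.cast_nonneg g) n).norm_left
  have h2 := (isBigO_pow_sub_pow g (-r) (Nat.cast_nonneg g) n).norm_left
  refine Asymptotics.IsBigO.trans (Asymptotics.IsBigO.of_bound' ?_) (h1.add h2)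
  filter_upwards [Filter.eventually_ge_atTop r] with h hh
  have hle : r ≤ g * h := hh.trans (Nat.le_mul_of_pos_left _ hg)
  set c := (invariantExponents r a (g * h)).ncard with hc
  have h3 : n.factorial * (r * c) ≤ (g * h + r + n) ^ n :=
    (Nat.mul_le_mul_left _ (mul_ncard_invariantExponents_le h0 _)).trans
      (factorial_mul_ncard_le_pow _)
  have h4 : (g * h - r) ^ n ≤ n.factorial * (r * c) := by
    refine (pow_le_factorial_mul_ncard hn _).trans (Nat.mul_le_mul_left _ ?_)
    have := ncard_le_mul_ncard_invariantExponents hr h0 (g * h - r)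
    rwa [Nat.sub_add_cancel hle] at this
  have h3' : (n.factorial * (r * c) : ℝ) ≤ (g * h + (r + n)) ^ n := by
    rw [← add_assoc]
    exact_mod_cast h3
  have h4' : ((g * h + -r) ^ n : ℝ) ≤ n.factorial * (r * c) := by
    have : (((g * h - r) ^ n : ℕ) : ℝ) ≤ (n.factorial * (r * c) : ℕ) := Nat.cast_le.mpr h4
    push_cast [Nat.cast_sub hle] at this
    rwa [← sub_eq_add_neg]
  have hrn : (1 : ℝ) ≤ r * n.factorial := by
    exact_mod_cast Nat.mul_pos hr n.factorial_pos
  have h5 : (c : ℝ) - ((g : ℝ) * h) ^ n / (r * n.factorial) =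
      (n.factorial * (r * c) - ((g : ℝ) * h) ^ n) / (r * n.factorial) := by
    field_simp
  simp only [Real.norm_eq_abs]
  rw [h5, abs_div, abs_of_pos (by positivity : (0 : ℝ) < r * n.factorial)]
  refine (div_le_self (abs_nonneg _) hrn).trans ?_
  rw [abs_of_nonneg (by positivity : 0 ≤ |((g * h + (r + n)) ^ n - (g * h) ^ n : ℝ)| +
    |((g * h + -r) ^ n - (g * h) ^ n : ℝ)|)]
  rw [abs_le]
  have h6 := le_abs_self ((g * h + (r + n)) ^ n - (g * h) ^ n : ℝ)
  have h7 := neg_abs_le ((g * h + -r) ^ n - (g * h) ^ n : ℝ)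
  have h8 := abs_nonneg ((g * h + (r + n)) ^ n - (g * h) ^ n : ℝ)
  have h9 := abs_nonneg ((g * h + -r) ^ n - (g * h) ^ n : ℝ)
  constructor <;> linarith

end Counting

end WMult

theorem theorem2p5 (n r : ℕ) (hn : 2 ≤ n) (hr : 0 < r) (a : Fin n → ℕ)
    (ha0 : a ⟨0, by omega⟩ = 1)
    (ha1 : Nat.Coprime (a ⟨1, by omega⟩) r)
    (har : ∀ j : Fin n, j.val ≠ 0 → a j < r)
    (l : ℕ)
    (hl : IsLeast {i : ℕ | 0 < i ∧ i ≤ r ∧ ∀ j : Fin n, a j * i ≡ i [MOD r]} l) :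
    WMult.HasWeightedMultiplicity (WMult.quotientStructure r a)
      (WMult.weightedBlowupMap r a (fun _ => (l : ℚ≥0) / (r : ℚ≥0)))
      (WMult.origin r a) n ((r : ℝ) ^ (n - 1) / (l : ℝ) ^ n) := by
  obtain ⟨⟨hl0, hlr, hla⟩, hmin⟩ := hl
  have hmin' : ∀ i, 0 < i → i ≤ r → (∀ j, a j * i ≡ i [MOD r]) → l ≤ i :=
    fun i h1 h2 h3 => hmin ⟨h1, h2, h3⟩
  -- Otherwise $r \bmod l$ would be a smaller positive solution of the congruences.
  obtain ⟨g, hg⟩ : l ∣ r := by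
    by_contra hdvd
    have h1 : 0 < r % l := Nat.pos_of_ne_zero fun h => hdvd (Nat.dvd_of_mod_eq_zero h)
    have h2 : r % l < l := Nat.mod_lt _ hl0
    refine absurd (hmin' (r % l) h1 (by omega) fun j => ?_) (not_le.mpr h2)
    have h3 : a j * (l * (r / l)) ≡ l * (r / l) [MOD r] := by
      rw [← mul_assoc]
      exact (hla j).mul_right _
    refine Nat.ModEq.add_left_cancel h3 ?_
    rw [← mul_add, Nat.div_add_mod]
    exact (Nat.modEq_zero_iff_dvd.mpr (dvd_mul_left r _)).trans
      (Nat.modEq_zero_iff_dvd.mpr dvd_rfl).symm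
  have hlg := hg.symm
  have hg0 : 0 < g := Nat.pos_of_ne_zero (by rintro rfl; omega)
  have hF := WMult.weightFiltration_isValuative hr hlg hla hmin' ha0
  have hx := WMult.origin_asIdeal hr hlg hla
  refine ⟨fun h => (WMult.invariantExponents r a (g * h)).ncard, fun h => ?_, ?_⟩
  · rw [← WMult.rank_quotient_weightFiltration hr hlg h]
    have h1 := WMult.pushforwardIdeal_blowupMap hF hx
      (WMult.weightFiltration_succ_le_span hr hlg) h
    have h2 := WMult.dimQuotient_map_specToStalk (WMult.origin r a) _
      fun b hb => WMult.isUnit_mk_of_notMem hr hlg hla h (hx ▸ hb)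
    rw [← h2, ← h1]
    rfl
  · have h1 := WMult.isBigO_ncard_invariantExponents (a := a) (by omega) hr ha0 hg0
    have h2 : ((n : ℤ) - 1) = ((n - 1 : ℕ) : ℤ) := by omega
    simp only [h2, zpow_natCast]
    refine h1.congr_left fun h => ?_
    congr 1
    -- The constants agree because $r=lg$ gives $g^n/r=r^{n-1}/l^n$.
    have h3 : (r : ℝ) = l * g := by exact_mod_cast hg
    obtain ⟨m, rfl⟩ : ∃ m, n = m + 1 := ⟨n - 1, by omega⟩
    have h4 : (l : ℝ) ≠ 0 := by positivity
    have h5 : (g : ℝ) ≠ 0 := by positivity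
    rw [h3, Nat.add_sub_cancel]
    field_simp
    ring
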